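/- **Setting.** There are $n$ pages with weights $w(p)>0$ and a cache of size $k$, $1\le k<n$, which is initially empty. A request sequence $B=(B_1,\dots,B_T)$ is served if after each time $t$ the cache holds $B_t$ and at most $k$ pages; the cost is the total weight of all evictions, and $\mathsf{OPT}$ is the minimum cost of serving $B$ offline. Let $A=(A_1,\dots,A_T)$ be a sequence of predicted requests, possibly wrong. An online algorithm with SPRP (strong per-request predictions) receives at time $t$ the request $B_t$ and the predicted requests $A_{t+1},A_{t+2},\dots$ up to and including the first $A_i=B_t$ with $i>t$ (all of $A_{t+1},\dots,A_T$ if there is none), and must then fix its cache contents. A randomized algorithm is a random choice of a deterministic one, and its cost is the expected cost on $A,B$ chosen independently of the random bits. Put $$\ell_1=\sum_{t:\,A_t\ne B_t}\bigl(w(A_t)+w(B_t)\bigr),$$ the distance of $A$ and $B$ in the weighted star metric. **Theorem.** 1. No deterministic algorithm with SPRP has cost $o(k)\cdot\mathsf{OPT}+o(\ell_1)$: there is no $f$ with $f(k)=o(k)$ as $k\to\infty$ such that for all $1\le k<n$ and all positive weights $w$ there are a deterministic algorithm with SPRP and a function $g$ with $g(x)=o(x)$ as $x\to\infty$ for which the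 cost is at most $f(k)\cdot\mathsf{OPT}+g(\ell_1)$ for all $A,B$ of equal length. 2. No randomized algorithm with SPRP has expected cost $o(\log k)\cdot\mathsf{OPT}+o(\ell_1)$, in the same sense with $f(k)=o(\log k)$. 3. There are an absolute constant $K$ and, for all $1\le k<n$ and all positive weights, a deterministic algorithm with SPRP whose cost is at most $K(\mathsf{OPT}+\ell_1)$ for all $A,B$ of equal length. 4. The deterministic algorithm FOLLOW serves every $B$ at cost at most $K(\mathsf{OPT}+\ell_1)$, for an absolute constant $K$. Here STATIC, run on $A$ with the correct predictions of $A$ itself, works in batches: when the first request of a batch arrives, say at time $s$, the batch consists of all requests $A_s,A_{s+1},\dots$ that are predicted so far (up to the largest next-request time, after its own time, of a request $A_r$, $r\le s$; all of $A$ if some such page is not requested again), and STATIC serves the batch by an optimal offline strategy from its current cache which only ever fetches the page being requested (such strategies exist, and any choice of them, as a function of the current cache and the batch, is allowed). FOLLOW runs STATIC on $A$ and imitates it on $B$: at every time, in place of each page in the cache of STATIC it holds $B_v$, where $v$ is the time at which that page was last requested in $A$. -/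

import Mathlib

open Filter Asymptotics MeasureTheory

universe u v

namespace WeightedPaging

/-- The cache contents `S`, listed after each request, serve the request sequence `R` with a cache
of size `k`: after the `t`-th request the cache holds the `t`-th requested page and has at most `k`
pages. (Arbitrary further fetches and evictions are allowed.) -/
def Serves {P : Type*} (k : ℕ) (R : List P) (S : List (Finset P)) : Prop :=
  List.Forall₂ (fun r C => r ∈ C ∧ C.card ≤ k) R S

/-- Total weight of the evicted pages when the cache contents are successively `C`, then the
entries of the list. Fetches are free. -/
def cost {P : Type*} [DecidableEq P] (w : P → ℝ) : Finset P → List (Finset P) → ℝ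
  | _, [] => 0
  | C, D :: S => ∑ p ∈ C \ D, w p + cost w D S

/-- Optimal offline cost for the request sequence `R`, from the empty cache. -/
noncomputable def opt {P : Type*} [DecidableEq P] (k : ℕ) (w : P → ℝ) (R : List P) : ℝ :=
  sInf {x | ∃ S, Serves k R S ∧ x = cost w ∅ S}

/-- The `ℓ₁` distance between a predicted sequence `A` and an input sequence `B` of the same
length, in the star metric in which the distance of `a ≠ b` is `w a + w b`. -/
def ell1 {P : Type*} [DecidableEq P] (w : P → ℝ) (A B : List P) : ℝ :=
  (List.zipWith (fun a b => if a = b then 0 else w a + w b) A B).sum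

/-- The initial part of a sequence up to and including the first occurrence of `p`
(the whole sequence if `p` does not occur). -/
def upTo {P : Type*} [DecidableEq P] (p : P) : List P → List P
  | [] => []
  | x :: l => if x = p then [x] else x :: upTo p l

/-- What an algorithm receives over time: at time `t` the request `B_t` together with its strong
per-request prediction, that is, the predicted requests `A_{t+1}, A_{t+2}, …` up to and including
the predicted next request of the page `B_t`. -/
def messages {P : Type*} [DecidableEq P] : List P → List P → List (P × List P)
  | _ :: A, b :: B => (b, upTo b A) :: messages A B
  | _, _ => []

/-- A deterministic online algorithm with SPRP: from the requests and predictions received so far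
(the latest ones included) it determines the cache contents after the latest request. -/
abbrev Algorithm (P : Type*) := List (P × List P) → Finset P

/-- The successive cache contents of an algorithm that receives `M`. -/
def Algorithm.run {P : Type*} (alg : Algorithm P) (M : List (P × List P)) : List (Finset P) :=
  (List.range M.length).map fun t => alg (M.take (t + 1))

/-- The algorithm serves every input, whatever the predictions are, with a cache of size `k`. -/
def Algorithm.IsFeasible {P : Type*} [DecidableEq P] (k : ℕ) (alg : Algorithm P) : Prop :=
  ∀ A B : List P, A.length = B.length → Serves k B (alg.run (messages A B))

/-- Cost of an algorithm on the input `B` with predictions `A`, from the empty cache. -/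
def Algorithm.cost {P : Type*} [DecidableEq P] (w : P → ℝ) (alg : Algorithm P) (A B : List P) :
    ℝ :=
  WeightedPaging.cost w ∅ (alg.run (messages A B))

/-- A randomized online algorithm with SPRP and cache size `k`: a random deterministic one. -/
structure RandomizedAlgorithm (P : Type v) [DecidableEq P] (k : ℕ) where
  /-- the sample space -/
  Ω : Type u
  [measurableSpace : MeasurableSpace Ω]
  /-- the law of the random bits -/
  μ : Measure Ω
  [isProbabilityMeasure : IsProbabilityMeasure μ]
  /-- the algorithm for given random bits -/
  alg : Ω → Algorithm P
  measurable : ∀ M C, MeasurableSet {ω | alg ω M = C}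
  feasible : ∀ ω, (alg ω).IsFeasible k

/-- Expected cost on the input `B` with predictions `A`; neither depends on the random bits. -/
noncomputable def RandomizedAlgorithm.cost {P : Type*} [DecidableEq P] {k : ℕ} (w : P → ℝ)
    (X : RandomizedAlgorithm P k) (A B : List P) : ℝ :=
  letI := X.measurableSpace
  ∫ ω, (X.alg ω).cost w A B ∂X.μ

/-! ### The algorithms `STATIC` and `FOLLOW` -/

/-- The cache changes from `C` through the list only by evictions and by fetching the currently
requested page. -/
def OnDemand {P : Type*} [DecidableEq P] : Finset P → List P → List (Finset P) → Prop
  | C, r :: R, D :: S => D ⊆ insert r C ∧ OnDemand D R S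
  | _, _, _ => True

/-- `σ` chooses, for every initial cache and every request sequence, an optimal offline strategy
that never fetches a page which is not being requested. -/
def IsOptimalOffline {P : Type*} [DecidableEq P] (k : ℕ) (w : P → ℝ)
    (σ : Finset P → List P → List (Finset P)) : Prop :=
  ∀ C R, Serves k R (σ C R) ∧ OnDemand C R (σ C R) ∧
    ∀ S, Serves k R S → cost w C (σ C R) ≤ cost w C S

/-- All requests, from time `1` on, that are known from the requests and (correct) predictions
received so far: the past ones and the predicted ones. -/
def known {P : Type*} : List (P × List P) → List P
  | [] => []
  | (p, L) :: M =>
    p :: if L.length ≤ (known M).length then known M else L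

/-- The successive cache contents of `STATIC` from a batch boundary on: `s` requests have been
served, the cache is `C`. The next batch consists of all requests that are known when its first
request arrives, and `σ` provides the strategy on it. Each batch is non-empty, so `fuel` only has
to be at least the number of requests that are still to be served. -/
def staticFrom {P : Type*} (σ : Finset P → List P → List (Finset P)) (M : List (P × List P)) :
    (fuel s : ℕ) → (C : Finset P) → List (Finset P)
  | 0, _, _ => []
  | fuel + 1, s, C =>
    if s < M.length then
      let X := σ C ((known (M.take (s + 1))).drop s)
      X ++ staticFrom σ M fuel (s + X.length) (X.getLastD C)
    else []

/-- The algorithm `STATIC`, with `σ` as its optimal offline strategy. -/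
def static {P : Type*} (σ : Finset P → List P → List (Finset P)) : Algorithm P :=
  fun M => (staticFrom σ M M.length 0 ∅).getD (M.length - 1) ∅

/-- The input page that was requested at the last time at which `p` was predicted. -/
def partner {P : Type*} [DecidableEq P] (AB : List (P × P)) (p : P) : P :=
  ((AB.reverse.find? fun x => x.1 = p).map Prod.snd).getD p

/-- The successive cache contents of `FOLLOW`: it runs `STATIC` on the predicted sequence `A` and
imitates it on `B`, keeping `B_v` in its cache in place of each page that `STATIC` has in its
cache, where `v` is the time at which that page was last requested in `A`. -/
def follow {P : Type*} [DecidableEq P] (σ : Finset P → List P → List (Finset P)) (A B : List P) :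
    List (Finset P) :=
  (List.range B.length).map fun t =>
    (static σ ((messages A A).take (t + 1))).image (partner ((A.zip B).take (t + 1)))

end WeightedPaging

open WeightedPaging

/-! Lower bounds. Take unit weights, `k + 2` pages, and predictions that always name page `0`, which
is never requested: they carry no information, and `ℓ₁` is twice the length `T`. On the other `k +
1` pages the marking adversary (`exists_adversary`) forces `Θ` expected misses per phase, with `Θ =
k` for deterministic and `Θ = H_k / 2` for randomized algorithms, while `OPT` pays at most 1 per
phase. Each request also contributes at least some `c > 0` depending only on `k`, so the misses grow
linearly in `T` and outweigh `o(ℓ₁)` (`false_of_adversary`).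

Upper bounds. Exchanging the requested pages turns a schedule for `B` into one for `A` that differs
from it by weight at most `ℓ₁` (`Serves.exists_gap_le`). A batch algorithm is compared with any
schedule `S` batch by batch (`cost_batchFrom_le`). Its plan is optimal on the batch, so up to errors
it exceeds `S` only by the difference of the initial caches. Afterwards it keeps only pages
requested in the batch; `S` has evicted those that it lacks, up to errors, so the new difference is
charged to `S` once more, whence the factor 2. A page that is not requested in a batch other than
the last is stale because of an error (`exists_error_of_notMem_batch`), so dropping it is charged to
`ℓ₁`. Correct predictions leave no stale pages, so `STATIC` is 2-competitive. The online algorithm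
`batchAlgorithm` forces each actual request into the planned cache (`force_serves`). For `FOLLOW`, a
potential that sums the star distances between the pages of `STATIC` and their partners pays for the
imitation (`follow_step_le`). -/

namespace WeightedPaging

variable {P : Type*} [DecidableEq P]

/-! ### Costs of schedules -/

theorem cost_append (w : P → ℝ) (C : Finset P) (S T : List (Finset P)) :
    cost w C (S ++ T) = cost w C S + cost w (S.getLastD C) T := by
  induction S generalizing C with
  | nil => simp [cost]
  | cons D S ih => rw [List.cons_append, cost, cost, ih, List.getLastD_cons, add_assoc]

theorem sum_le_of_subset_union {w : P → ℝ} (hw : ∀ p, 0 ≤ w p) {C D E : Finset P}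
    (h : C ⊆ D ∪ E) : ∑ p ∈ C, w p ≤ ∑ p ∈ D, w p + ∑ p ∈ E, w p := by
  refine (Finset.sum_le_sum_of_subset_of_nonneg h fun p _ _ => hw p).trans ?_
  rw [← Finset.sum_union_inter]
  exact le_add_of_nonneg_right (Finset.sum_nonneg fun p _ => hw p)

theorem sum_sdiff_triangle {w : P → ℝ} (hw : ∀ p, 0 ≤ w p) (C D E : Finset P) :
    ∑ p ∈ C \ E, w p ≤ ∑ p ∈ C \ D, w p + ∑ p ∈ D \ E, w p := by
  apply sum_le_of_subset_union hw
  intro p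
  simp only [Finset.mem_sdiff, Finset.mem_union]
  tauto

theorem cost_nonneg {w : P → ℝ} (hw : ∀ p, 0 ≤ w p) (C : Finset P) (S : List (Finset P)) :
    0 ≤ cost w C S := by
  induction S generalizing C with
  | nil => simp [cost]
  | cons D S ih => exact add_nonneg (Finset.sum_nonneg fun p _ => hw p) (ih D)

/-- The total weight by which two schedules differ. -/
def gap (w : P → ℝ) (S F : List (Finset P)) : ℝ :=
  (List.zipWith (fun D E => ∑ p ∈ D \ E, w p + ∑ p ∈ E \ D, w p) S F).sum

/-- Each step of `F` is replaced by a detour through `S`: a pair `(D, E)` is charged `D \ E` on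
arrival at `E` and `E \ D` on departure. -/
theorem cost_le_cost_add_gap {w : P → ℝ} (hw : ∀ p, 0 ≤ w p) {S F : List (Finset P)}
    (h : S.length = F.length) (C C' : Finset P) :
    cost w C' F ≤ ∑ p ∈ C' \ C, w p + cost w C S + gap w S F := by
  induction S generalizing F C C' with
  | nil =>
    obtain rfl := List.length_eq_zero_iff.1 h.symm
    simpa [cost, gap] using Finset.sum_nonneg fun p _ => hw p
  | cons D S ih =>
    obtain _ | ⟨E, F⟩ := F
    · simp at h
    · have h1 := ih (F := F) (by simpa using h) D E
      have h2 := sum_sdiff_triangle hw C' C E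
      have h3 := sum_sdiff_triangle hw C D E
      simp only [cost, gap, List.zipWith_cons_cons, List.sum_cons] at h1 ⊢
      linarith

theorem cost_le_add_cost {w : P → ℝ} (hw : ∀ p, 0 ≤ w p) (S : List (Finset P))
    (C C' : Finset P) : cost w C' S ≤ ∑ p ∈ C' \ C, w p + cost w C S := by
  have h := cost_le_cost_add_gap hw (rfl : S.length = S.length) C C'
  have h0 : gap w S S = 0 := by simp [gap]
  linarith

/-! ### The star metric -/

/-- The distance of two points in the weighted star metric. -/
def starDist (w : P → ℝ) (a b : P) : ℝ := if a = b then 0 else w a + w b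

theorem starDist_nonneg {w : P → ℝ} (hw : ∀ p, 0 ≤ w p) (a b : P) : 0 ≤ starDist w a b := by
  unfold starDist
  split_ifs
  exacts [le_rfl, add_nonneg (hw a) (hw b)]

@[simp] theorem ell1_nil (w : P → ℝ) (B : List P) : ell1 w [] B = 0 := by simp [ell1]

theorem ell1_cons (w : P → ℝ) (a b : P) (A B : List P) :
    ell1 w (a :: A) (b :: B) = starDist w a b + ell1 w A B := by
  simp [ell1, starDist]

theorem ell1_self (w : P → ℝ) (A : List P) : ell1 w A A = 0 := by
  induction A with
  | nil => simp
  | cons a A ih => simp [ell1_cons, starDist, ih]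

theorem ell1_append (w : P → ℝ) {A A' B B' : List P} (h : A.length = B.length) :
    ell1 w (A ++ A') (B ++ B') = ell1 w A B + ell1 w A' B' := by
  simp [ell1, List.zipWith_append h]

theorem ell1_nonneg {w : P → ℝ} (hw : ∀ p, 0 ≤ w p) (A B : List P) : 0 ≤ ell1 w A B := by
  induction A generalizing B with
  | nil => simp
  | cons a A ih =>
    obtain _ | ⟨b, B⟩ := B
    · simp [ell1]
    · rw [ell1_cons]
      exact add_nonneg (starDist_nonneg hw a b) (ih B)

/-- Batch algorithms serve a mixture of predictions and requests; entries taken from `B` contribute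
nothing to the distance. -/
theorem ell1_le_of_forall {w : P → ℝ} (hw : ∀ p, 0 ≤ w p) {R A B : List P}
    (hR : R.length = B.length) (hA : A.length = B.length)
    (h : ∀ i < B.length, R[i]? = A[i]? ∨ R[i]? = B[i]?) : ell1 w R B ≤ ell1 w A B := by
  induction B generalizing R A with
  | nil => simp [ell1]
  | cons b B ih =>
    obtain _ | ⟨r, R⟩ := R
    · simp at hR
    obtain _ | ⟨a, A⟩ := A
    · simp at hA
    rw [ell1_cons, ell1_cons]
    have h1 := ih (R := R) (A := A) (by simpa using hR) (by simpa using hA) fun i hi => by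
      simpa using h (i + 1) (by simpa using hi)
    have h0 := h 0 (by simp)
    simp only [List.getElem?_cons_zero, Option.some.injEq] at h0
    rcases h0 with rfl | rfl
    · linarith
    · have := starDist_nonneg hw a r
      simp only [starDist, if_true] at this ⊢
      linarith

/-- The pages involved in prediction errors weigh at most the `ℓ₁` distance. -/
theorem sum_le_ell1 {w : P → ℝ} (hw : ∀ p, 0 ≤ w p) {A B : List P} {Y : Finset P}
    (h : ∀ p ∈ Y, ∃ x ∈ A.zip B, x.1 ≠ x.2 ∧ (p = x.1 ∨ p = x.2)) :
    ∑ p ∈ Y, w p ≤ ell1 w A B := by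
  induction A generalizing B Y with
  | nil =>
    have : Y = ∅ := Finset.eq_empty_of_forall_notMem fun p hp => by simpa using h p hp
    simp [this]
  | cons a A ih =>
    obtain _ | ⟨b, B⟩ := B
    · have : Y = ∅ := Finset.eq_empty_of_forall_notMem fun p hp => by simpa using h p hp
      simp [this, ell1]
    rw [ell1_cons]
    by_cases hab : a = b
    · have := ih (B := B) (Y := Y) fun p hp => by
        obtain ⟨x, hx, hne, hpx⟩ := h p hp
        rw [List.zip_cons_cons, List.mem_cons] at hx
        rcases hx with rfl | hx
        · exact absurd hab hne
        · exact ⟨x, hx, hne, hpx⟩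
      simpa [starDist, hab] using this
    · have h1 := ih (B := B) (Y := Y \ {a, b}) fun p hp => by
        rw [Finset.mem_sdiff] at hp
        obtain ⟨x, hx, hne, hpx⟩ := h p hp.1
        rw [List.zip_cons_cons, List.mem_cons] at hx
        rcases hx with rfl | hx
        · exact absurd (by simpa using hpx) hp.2
        · exact ⟨x, hx, hne, hpx⟩
      have h2 : ∑ p ∈ Y, w p ≤ ∑ p ∈ {a, b}, w p + ∑ p ∈ Y \ {a, b}, w p :=
        sum_le_of_subset_union hw (fun p hp => by simp [hp])
      rw [Finset.sum_pair hab] at h2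
      simp only [starDist, hab, if_false]
      linarith

/-- The `ℓ₁` distance from time `s` on. -/
def ell1From (w : P → ℝ) (A B : List P) (s : ℕ) : ℝ := ell1 w (A.drop s) (B.drop s)

theorem ell1From_eq (w : P → ℝ) {A B : List P} (h : A.length = B.length) (s m : ℕ) :
    ell1From w A B s =
      ell1 w ((A.drop s).take m) ((B.drop s).take m) + ell1From w A B (s + m) := by
  unfold ell1From
  conv_lhs => rw [← List.take_append_drop m (A.drop s), ← List.take_append_drop m (B.drop s)]
  rw [ell1_append w (by simp [h]), List.drop_drop, List.drop_drop]

theorem sum_le_ell1From_sub {w : P → ℝ} (hw : ∀ p, 0 ≤ w p) {A B : List P}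
    (hAB : A.length = B.length) {Y : Finset P} {s e : ℕ} (hse : s ≤ e)
    (h : ∀ p ∈ Y, ∃ r a b, s ≤ r ∧ r < e ∧ A[r]? = some a ∧ B[r]? = some b ∧ a ≠ b ∧
      (p = a ∨ p = b)) :
    ∑ p ∈ Y, w p ≤ ell1From w A B s - ell1From w A B e := by
  obtain ⟨m, rfl⟩ := Nat.exists_eq_add_of_le hse
  rw [ell1From_eq w hAB s m, add_sub_cancel_right]
  apply sum_le_ell1 hw
  intro p hp
  obtain ⟨r, a, b, hr, hr', ha, hb, hab, hpab⟩ := h p hp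
  refine ⟨(a, b), ?_, hab, hpab⟩
  rw [List.mem_iff_getElem?]
  refine ⟨r - s, ?_⟩
  rw [List.getElem?_zip_eq_some, List.getElem?_take_of_lt (by omega), List.getElem?_drop,
    List.getElem?_take_of_lt (by omega), List.getElem?_drop, Nat.add_sub_cancel' hr]
  exact ⟨ha, hb⟩

/-! ### Comparison of schedules -/

theorem Serves.length_eq {P : Type*} {k : ℕ} {R : List P} {S : List (Finset P)} (h : Serves k R S) :
    R.length = S.length :=
  List.Forall₂.length_eq h

/-- A schedule for `B` can be turned into one for `A` by exchanging the requested pages. -/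
theorem Serves.exists_gap_le {w : P → ℝ} {k : ℕ} {A B : List P} {S : List (Finset P)}
    (hw : ∀ p, 0 ≤ w p) (hAB : A.length = B.length) (hS : Serves k B S) :
    ∃ S', Serves k A S' ∧ gap w S S' ≤ ell1 w A B := by
  induction hS generalizing A with
  | nil =>
    obtain rfl := List.length_eq_zero_iff.1 hAB
    exact ⟨[], List.Forall₂.nil, by simp [gap]⟩
  | @cons b D B S hD hS ih =>
    obtain _ | ⟨a, A⟩ := A
    · simp at hAB
    obtain ⟨S', hS', hg⟩ := ih (A := A) (by simpa using hAB)
    by_cases hab : a = b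
    · subst hab
      refine ⟨D :: S', List.Forall₂.cons hD hS', ?_⟩
      rw [ell1_cons]
      simpa [gap, starDist] using hg
    · refine ⟨insert a (D.erase b) :: S', List.Forall₂.cons ⟨by simp, ?_⟩ hS', ?_⟩
      · refine (Finset.card_insert_le _ _).trans ?_
        rw [Finset.card_erase_of_mem hD.1]
        have := Finset.card_pos.2 ⟨b, hD.1⟩
        omega
      · have h1 : ∑ p ∈ D \ insert a (D.erase b), w p ≤ ∑ p ∈ {b}, w p :=
          Finset.sum_le_sum_of_subset_of_nonneg (fun p => by
            simp only [Finset.mem_sdiff, Finset.mem_insert, Finset.mem_erase,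
              Finset.mem_singleton]; tauto) fun p _ _ => hw p
        have h2 : ∑ p ∈ insert a (D.erase b) \ D, w p ≤ ∑ p ∈ {a}, w p :=
          Finset.sum_le_sum_of_subset_of_nonneg (fun p => by
            simp only [Finset.mem_sdiff, Finset.mem_insert, Finset.mem_erase,
              Finset.mem_singleton]; tauto) fun p _ _ => hw p
        rw [ell1_cons]
        simp only [Finset.sum_singleton] at h1 h2
        simp only [gap, List.zipWith_cons_cons, List.sum_cons, starDist, hab, if_false] at hg ⊢
        linarith

/-- A schedule pays for the pages that it once held and does not hold at the end. -/
theorem Serves.sum_sdiff_getLastD_le_cost {w : P → ℝ} {k : ℕ} {R : List P}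
    {S : List (Finset P)} (hw : ∀ p, 0 ≤ w p) (h : Serves k R S) (C : Finset P) :
    ∑ p ∈ (C ∪ R.toFinset) \ S.getLastD C, w p ≤ cost w C S := by
  induction h generalizing C with
  | nil => simp [cost]
  | @cons r D R S hD hS ih =>
    rw [cost, List.getLastD_cons]
    refine (sum_le_of_subset_union hw (D := C \ D) (fun p => ?_)).trans
      (add_le_add_right (ih D) _)
    have := hD.1
    simp only [List.toFinset_cons, Finset.mem_sdiff, Finset.mem_union, Finset.mem_insert]
    rintro ⟨h | rfl | h, h'⟩ <;> tauto

/-- A page of `R` that occurs in `B` was held by `S` at some time, hence evicted if it is missing at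
the end. Any other page of `R` disagrees with `B` at its position. -/
theorem Serves.sum_toFinset_sdiff_le {w : P → ℝ} {k : ℕ} {R B : List P} {S : List (Finset P)}
    (hw : ∀ p, 0 ≤ w p) (h : Serves k B S) (hRB : R.length = B.length) (C : Finset P) :
    ∑ p ∈ R.toFinset \ S.getLastD C, w p ≤ cost w C S + ell1 w R B := by
  have h1 := h.sum_sdiff_getLastD_le_cost hw C
  have h2 : ∑ p ∈ R.toFinset \ B.toFinset, w p ≤ ell1 w R B := by
    apply sum_le_ell1 hw
    intro p hp
    rw [Finset.mem_sdiff, List.mem_toFinset, List.mem_toFinset] at hp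
    obtain ⟨i, hi, rfl⟩ := List.mem_iff_getElem.1 hp.1
    refine ⟨(R[i], B[i]), ?_, ?_, Or.inl rfl⟩
    · rw [List.mem_iff_getElem]
      exact ⟨i, by simp; omega, by simp⟩
    · intro h
      apply hp.2
      change R[i] = B[i] at h
      rw [h]
      exact List.getElem_mem _
  refine (sum_le_of_subset_union hw (E := R.toFinset \ B.toFinset) fun p => ?_).trans
    (add_le_add h1 h2)
  simp only [Finset.mem_sdiff, Finset.mem_union]
  tauto

/-! ### On-demand schedules -/

theorem OnDemand.mono {C C' : Finset P} (hC : C ⊆ C') {R : List P} {S : List (Finset P)}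
    (h : OnDemand C R S) : OnDemand C' R S := by
  match R, S, h with
  | [], _, _ => simp [OnDemand]
  | _ :: _, [], _ => simp [OnDemand]
  | r :: R, D :: S, h => exact ⟨h.1.trans (Finset.insert_subset_insert r hC), h.2⟩

theorem OnDemand.append {C C' : Finset P} {R R' : List P} {S S' : List (Finset P)}
    (hl : R.length = S.length) (h : OnDemand C R S) (hC : C' ⊆ S.getLastD C)
    (h' : OnDemand C' R' S') : OnDemand C (R ++ R') (S ++ S') := by
  induction R generalizing C S with
  | nil =>
    obtain rfl := List.length_eq_zero_iff.1 hl.symm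
    exact h'.mono hC
  | cons r R ih =>
    obtain _ | ⟨D, S⟩ := S
    · simp at hl
    · rw [List.getLastD_cons] at hC
      exact ⟨h.1, ih (by simpa using hl) h.2 hC⟩

theorem OnDemand.getLastD_subset {C : Finset P} {R : List P} {S : List (Finset P)}
    (hl : R.length = S.length) (h : OnDemand C R S) : S.getLastD C ⊆ C ∪ R.toFinset := by
  induction R generalizing C S with
  | nil =>
    obtain rfl := List.length_eq_zero_iff.1 hl.symm
    simp
  | cons r R ih =>
    obtain _ | ⟨D, S⟩ := S
    · simp at hl
    · rw [List.getLastD_cons]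
      refine (ih (by simpa using hl) h.2).trans ?_
      intro p hp
      have := @h.1 p
      simp only [List.toFinset_cons, Finset.mem_union, Finset.mem_insert] at *
      tauto

/-- The lazy copy keeps only those pages of `D` that it already has or that are being requested. It
stays inside the original cache and so evicts nothing extra. -/
theorem Serves.exists_onDemand {w : P → ℝ} {k : ℕ} {R : List P} {S : List (Finset P)}
    (hw : ∀ p, 0 ≤ w p) (h : Serves k R S) (C C' : Finset P) (hC : C' ⊆ C) :
    ∃ S', Serves k R S' ∧ OnDemand C' R S' ∧ cost w C' S' ≤ cost w C S := by
  induction h generalizing C C' with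
  | nil => exact ⟨[], List.Forall₂.nil, trivial, by simp [cost]⟩
  | @cons r D R S hD hS ih =>
    obtain ⟨S', h1, h2, h3⟩ := ih D (D ∩ insert r C') Finset.inter_subset_left
    refine ⟨(D ∩ insert r C') :: S', List.Forall₂.cons ⟨by simp [hD.1], ?_⟩ h1,
      ⟨Finset.inter_subset_right, h2⟩, ?_⟩
    · exact (Finset.card_le_card Finset.inter_subset_left).trans hD.2
    · refine add_le_add (Finset.sum_le_sum_of_subset_of_nonneg (fun p hp => ?_)
        fun p _ _ => hw p) h3
      have := @hC p
      simp only [Finset.mem_sdiff, Finset.mem_inter, Finset.mem_insert] at *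
      tauto

theorem exists_serves {P : Type*} {k : ℕ} (hk : 1 ≤ k) (R : List P) : ∃ S, Serves k R S :=
  ⟨R.map fun p => {p}, by
    unfold Serves
    rw [List.forall₂_map_right_iff, List.forall₂_same]
    exact fun p _ => ⟨by simp, by simpa⟩⟩

theorem exists_isOptimalOffline [Finite P] {k : ℕ} (hk : 1 ≤ k) {w : P → ℝ}
    (hw : ∀ p, 0 ≤ w p) : ∃ σ, IsOptimalOffline k w σ := by
  have key : ∀ (C : Finset P) (R : List P), ∃ S, Serves k R S ∧ OnDemand C R S ∧
      ∀ S', Serves k R S' → cost w C S ≤ cost w C S' := by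
    intro C R
    have hfin : {S : List (Finset P) | Serves k R S}.Finite :=
      (List.finite_length_eq (Finset P) R.length).subset fun S hS => hS.length_eq.symm
    obtain ⟨S, hS, hmin⟩ := Set.exists_min_image _ (cost w C) hfin (exists_serves hk R)
    obtain ⟨S', h1, h2, h3⟩ := Serves.exists_onDemand hw hS C C subset_rfl
    exact ⟨S', h1, h2, fun T hT => h3.trans (hmin T hT)⟩
  choose σ h using key
  exact ⟨σ, h⟩

theorem le_opt {k : ℕ} (hk : 1 ≤ k) {w : P → ℝ} {B : List P} {x : ℝ}
    (h : ∀ S, Serves k B S → x ≤ cost w ∅ S) : x ≤ opt k w B := by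
  obtain ⟨S, hS⟩ := exists_serves hk B
  refine le_csInf ⟨_, S, hS, rfl⟩ ?_
  rintro _ ⟨S, hS, rfl⟩
  exact h S hS

theorem opt_le {k : ℕ} {w : P → ℝ} (hw : ∀ p, 0 ≤ w p) {B : List P} {S : List (Finset P)}
    (hS : Serves k B S) : opt k w B ≤ cost w ∅ S := by
  refine csInf_le ⟨0, ?_⟩ ⟨S, hS, rfl⟩
  rintro _ ⟨S, _, rfl⟩
  exact cost_nonneg hw _ _

/-! ### What is known from the messages -/

theorem upTo_isPrefix (p : P) (l : List P) : upTo p l <+: l := by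
  induction l with
  | nil => simp [upTo]
  | cons x l ih =>
    rw [upTo]
    split_ifs
    · simp
    · simpa using ih

theorem length_upTo_or (p : P) (l : List P) :
    (upTo p l).length = l.length ∨ ∃ i < (upTo p l).length, l[i]? = some p := by
  induction l with
  | nil => simp [upTo]
  | cons x l ih =>
    rw [upTo]
    split_ifs with h
    · exact Or.inr ⟨0, by simp, by simp [h]⟩
    · rcases ih with h | ⟨i, hi, h⟩
      · exact Or.inl (by simp [h])
      · exact Or.inr ⟨i + 1, by simpa using hi, by simpa using h⟩

theorem length_messages {A B : List P} (h : A.length = B.length) :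
    (messages A B).length = B.length := by
  induction A generalizing B with
  | nil => simp [← h, messages]
  | cons a A ih =>
    obtain _ | ⟨b, B⟩ := B
    · simp at h
    · simp [messages, ih (B := B) (by simpa using h)]

theorem length_le_length_known {P : Type*} (M : List (P × List P)) :
    M.length ≤ (known M).length := by
  induction M with
  | nil => simp
  | cons m M ih =>
    obtain ⟨p, L⟩ := m
    rw [known, List.length_cons, List.length_cons]
    split_ifs <;> omega

/-- After `s` messages, the known sequence agrees with the predictions from time `s` on, and with
the predictions or the requests before; unless it is complete, it contains an occurrence of
each of the first `s` requests after the time of the request. -/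
theorem known_messages {A B : List P} (hAB : A.length = B.length) (s : ℕ) :
    (known ((messages A B).take s)).length ≤ A.length ∧
    (∀ i < (known ((messages A B).take s)).length,
      (known ((messages A B).take s))[i]? = A[i]? ∨
        i < s ∧ (known ((messages A B).take s))[i]? = B[i]?) ∧
    (∀ r < s, ∀ p, B[r]? = some p → (known ((messages A B).take s)).length = A.length ∨
      ∃ i, r < i ∧ i < (known ((messages A B).take s)).length ∧ A[i]? = some p) := by
  induction A generalizing B s with
  | nil =>
    obtain rfl := List.length_eq_zero_iff.1 hAB.symm
    simp [messages, known]
  | cons a A ih =>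
    obtain _ | ⟨b, B⟩ := B
    · simp at hAB
    obtain _ | s := s
    · simp [known]
    obtain ⟨h1, h2, h3⟩ := ih (B := B) (by simpa using hAB) s
    obtain ⟨Z, hZ⟩ := upTo_isPrefix b A
    have hU := length_upTo_or b A
    have hUl : (upTo b A).length ≤ A.length := (upTo_isPrefix b A).length_le
    simp only [messages, List.take_succ_cons, known]
    set κ := known ((messages A B).take s) with hκ
    refine ⟨?_, ?_, ?_⟩
    · split_ifs
      · simpa using h1
      · simpa using hUl
    · rintro (_ | i) hi
      · simp
      · split_ifs at hi ⊢ with hc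
        · simpa using h2 i (by simpa using hi)
        · left
          have hi' : i < (upTo b A).length := by simpa using hi
          rw [List.getElem?_cons_succ, List.getElem?_cons_succ]
          conv_rhs => rw [← hZ]
          rw [List.getElem?_append_left hi']
    · rintro (_ | r) hr p hp
      · obtain rfl : b = p := by simpa using hp
        -- The prediction for `b` exhausts `A` or ends with an occurrence of `b`; the known sequence
        -- is at least that long whether or not an older, longer one is kept.
        rcases hU with hU | ⟨i, hi, hU⟩
        · left
          split_ifs with hc
          · simp; omega
          · simp [hU]
        · right
          refine ⟨i + 1, by omega, ?_, by simpa using hU⟩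
          split_ifs with hc
          · simp; omega
          · simpa using hi
      · rcases h3 r (by omega) p (by simpa using hp) with h | ⟨i, hi, hi', h⟩
        · left
          split_ifs with hc
          · simp [h]
          · simp; omega
        · right
          refine ⟨i + 1, by omega, ?_, by simpa using h⟩
          split_ifs with hc
          · simpa using hi'
          · simp; omega

/-- The requests of the batch that starts at time `s`. -/
def batch {P : Type*} (M : List (P × List P)) (s : ℕ) : List P :=
  (known (M.take (s + 1))).drop s

theorem length_batch_pos {P : Type*} {M : List (P × List P)} {s : ℕ} (hs : s < M.length) :
    0 < (batch M s).length := by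
  have := length_le_length_known (M.take (s + 1))
  simp only [List.length_take] at this
  simp only [batch, List.length_drop]
  omega

theorem add_length_batch_le {A B : List P} (hAB : A.length = B.length) {s : ℕ}
    (hs : s < A.length) : s + (batch (messages A B) s).length ≤ A.length := by
  have := (known_messages hAB (s + 1)).1
  simp only [batch, List.length_drop]
  omega

/-- Only at its first position can a batch contain an actual request; the rest is still in the
future. -/
theorem batch_getElem? {A B : List P} (hAB : A.length = B.length) {s i : ℕ}
    (hi : i < (batch (messages A B) s).length) :
    (batch (messages A B) s)[i]? = A[s + i]? ∨
      i = 0 ∧ (batch (messages A B) s)[i]? = B[s + i]? := by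
  simp only [batch, List.length_drop, List.getElem?_drop] at hi ⊢
  rcases (known_messages hAB (s + 1)).2.1 (s + i) (by omega) with h | ⟨h, h'⟩
  · exact Or.inl h
  · exact Or.inr ⟨by omega, h'⟩

theorem exists_request_in_batch {A B : List P} (hAB : A.length = B.length) {s r : ℕ}
    (hs : s + (batch (messages A B) s).length < A.length) (hr : r ≤ s) {p : P}
    (hp : B[r]? = some p) :
    ∃ i, r < i ∧ i < s + (batch (messages A B) s).length ∧ A[i]? = some p := by
  rcases (known_messages hAB (s + 1)).2.2 r (by omega) p hp with h | ⟨i, hi, hi', h⟩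
  · simp only [batch, List.length_drop] at hs
    omega
  · refine ⟨i, hi, ?_, h⟩
    simp only [batch, List.length_drop]
    omega

theorem ell1_batch_le {w : P → ℝ} (hw : ∀ p, 0 ≤ w p) {A B : List P}
    (hAB : A.length = B.length) {s : ℕ} (hs : s < A.length) :
    ell1 w (batch (messages A B) s) ((B.drop s).take (batch (messages A B) s).length) ≤
      ell1From w A B s - ell1From w A B (s + (batch (messages A B) s).length) := by
  have hle := add_length_batch_le hAB hs
  rw [ell1From_eq w hAB s (batch (messages A B) s).length, add_sub_cancel_right]
  apply ell1_le_of_forall hw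
  · simp; omega
  · simp [hAB]
  · intro i hi
    have hi' : i < (batch (messages A B) s).length := by simp at hi; omega
    rw [List.getElem?_take_of_lt hi', List.getElem?_take_of_lt hi', List.getElem?_drop,
      List.getElem?_drop]
    exact (batch_getElem? hAB hi').imp id And.right

/-! ### Algorithms that work in batches -/

/-- The variant of `staticFrom` in which the cache `C` at the end of a batch with the requests `R`
is replaced by `next R C`. -/
def batchFrom {P : Type*} (next : List P → Finset P → Finset P)
    (σ : Finset P → List P → List (Finset P)) (M : List (P × List P)) :
    (fuel s : ℕ) → (C : Finset P) → List (Finset P)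
  | 0, _, _ => []
  | fuel + 1, s, C =>
    if s < M.length then
      σ C (batch M s) ++ batchFrom next σ M fuel (s + (σ C (batch M s)).length)
        (next (batch M s) ((σ C (batch M s)).getLastD C))
    else []

theorem staticFrom_eq_batchFrom {P : Type*} (σ : Finset P → List P → List (Finset P))
    (M : List (P × List P)) (fuel s : ℕ) (C : Finset P) :
    staticFrom σ M fuel s C = batchFrom (fun _ C => C) σ M fuel s C := by
  induction fuel generalizing s C with
  | zero => rfl
  | succ fuel ih =>
    rw [staticFrom, batchFrom]
    split_ifs
    · simp only [ih]
      rfl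
    · rfl

theorem batchFrom_of_length_le {P : Type*} {next : List P → Finset P → Finset P}
    {σ : Finset P → List P → List (Finset P)} {M : List (P × List P)} {s : ℕ}
    (hs : M.length ≤ s) (fuel : ℕ) (C : Finset P) : batchFrom next σ M fuel s C = [] := by
  cases fuel with
  | zero => rfl
  | succ fuel => rw [batchFrom, if_neg (by omega)]

/-- The schedule of a batch algorithm does not depend on the future. -/
theorem batchFrom_take {P : Type*} {next : List P → Finset P → Finset P}
    {σ : Finset P → List P → List (Finset P)} (hσ : ∀ C R, (σ C R).length = R.length)
    {M : List (P × List P)} {j : ℕ} (hj : j ≤ M.length) (fuel fuel' s i : ℕ) (C : Finset P)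
    (hi : s + i < j) (hf : j ≤ fuel + s) (hf' : M.length ≤ fuel' + s) :
    (batchFrom next σ (M.take j) fuel s C)[i]? = (batchFrom next σ M fuel' s C)[i]? := by
  induction fuel generalizing fuel' s i C with
  | zero => omega
  | succ fuel ih =>
    obtain _ | fuel' := fuel'
    · omega
    -- A batch is determined by the messages up to its first request, and these survive the
    -- truncation.
    have hb : batch (M.take j) s = batch M s := by
      rw [batch, batch, List.take_take, min_eq_left (by omega)]
    have hpos : 0 < (batch M s).length := length_batch_pos (by omega)
    rw [batchFrom, batchFrom, if_pos (by simp; omega), if_pos (by omega), hb]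
    rcases lt_or_ge i (σ C (batch M s)).length with h | h
    · rw [List.getElem?_append_left h, List.getElem?_append_left h]
    · rw [List.getElem?_append_right h, List.getElem?_append_right h]
      rw [hσ] at h ⊢
      exact ih _ _ _ _ (by omega) (by omega) (by omega)

theorem IsOptimalOffline.length_eq {k : ℕ} {w : P → ℝ}
    {σ : Finset P → List P → List (Finset P)} (hσ : IsOptimalOffline k w σ) (C : Finset P)
    (R : List P) : (σ C R).length = R.length :=
  (hσ C R).1.length_eq.symm

/-- A batch algorithm serves, on demand, a sequence mixed from predictions and requests. -/
theorem batchFrom_serves {k : ℕ} {w : P → ℝ} {next : List P → Finset P → Finset P}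
    (hnext : ∀ R C, next R C ⊆ C)
    {σ : Finset P → List P → List (Finset P)} (hσ : IsOptimalOffline k w σ) {A B : List P}
    (hAB : A.length = B.length) (fuel s : ℕ) (C : Finset P) (hs : s ≤ A.length)
    (hf : A.length ≤ fuel + s) :
    ∃ R, R.length = A.length - s ∧
      (∀ i < R.length, R[i]? = A[s + i]? ∨ R[i]? = B[s + i]?) ∧
      Serves k R (batchFrom next σ (messages A B) fuel s C) ∧
      OnDemand C R (batchFrom next σ (messages A B) fuel s C) := by
  have hl := length_messages hAB
  induction fuel generalizing s C with
  | zero =>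
    exact ⟨[], by simp; omega, by simp, List.Forall₂.nil, trivial⟩
  | succ fuel ih =>
    rcases hs.eq_or_lt with rfl | hs
    · rw [batchFrom_of_length_le (by omega)]
      exact ⟨[], by simp, by simp, List.Forall₂.nil, trivial⟩
    · have hpos := length_batch_pos (M := messages A B) (s := s) (by omega)
      have hle := add_length_batch_le hAB hs
      rw [batchFrom, if_pos (by omega), hσ.length_eq]
      obtain ⟨R, h1, h2, h3, h4⟩ := ih (s + (batch (messages A B) s).length)
        (next (batch (messages A B) s)
          ((σ C (batch (messages A B) s)).getLastD C)) hle (by omega)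
      refine ⟨batch (messages A B) s ++ R, ?_, ?_, ?_, ?_⟩
      · rw [List.length_append]
        omega
      · intro i hi
        rcases lt_or_ge i (batch (messages A B) s).length with h | h
        · rw [List.getElem?_append_left h]
          exact (batch_getElem? hAB h).imp id And.right
        · rw [List.getElem?_append_right h]
          rw [List.length_append] at hi
          have := h2 (i - (batch (messages A B) s).length) (by omega)
          rwa [add_assoc, Nat.add_sub_cancel' h] at this
      · exact List.rel_append (hσ _ _).1 h3
      · exact (hσ _ _).2.1.append (hσ.length_eq _ _).symm (hnext _ _) h4

/-- The pages of `C` that are requested in `R`. -/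
def keepRequested (R : List P) (C : Finset P) : Finset P := C ∩ R.toFinset

/-- A page requested or predicted since time `u` that does not occur in the batch at time `s` is
involved in a prediction error. -/
theorem exists_error_of_notMem_batch {A B : List P} (hAB : A.length = B.length) {u s : ℕ}
    (hs : s + (batch (messages A B) s).length < A.length) {p : P}
    (hp : ∃ r, u ≤ r ∧ r < s ∧ (A[r]? = some p ∨ B[r]? = some p))
    (hpR : p ∉ batch (messages A B) s) :
    ∃ r a b, u ≤ r ∧ r < s + 1 ∧ A[r]? = some a ∧ B[r]? = some b ∧ a ≠ b ∧
      (p = a ∨ p = b) := by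
  by_contra! hcon
  -- Without an error involving `p`, its occurrences in the two sequences coincide. Time `s` is
  -- included because the batch may start with `B_s` instead of `A_s`.
  have hsame : ∀ r, u ≤ r → r < s + 1 → (A[r]? = some p ∨ B[r]? = some p) →
      A[r]? = some p ∧ B[r]? = some p := by
    intro r hur hrs h
    have ha : A[r]? = some A[r] := List.getElem?_eq_getElem (by omega)
    have hb : B[r]? = some B[r] := List.getElem?_eq_getElem (by omega)
    have := hcon r _ _ hur hrs ha hb
    rw [ha, hb] at h ⊢
    simp only [Option.some.injEq] at h ⊢
    by_contra hne
    rcases h with h | h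
    · exact (this fun e => hne ⟨h, e.symm.trans h⟩).1 h.symm
    · exact (this fun e => hne ⟨e.trans h, h⟩).2 h.symm
  -- The last request of `p` before `s` announces the next predicted occurrence of `p`, which by
  -- maximality is not before `s` and hence lies in the batch.
  have hlast : ∃ r, u ≤ r ∧ r < s ∧ A[r]? = some p ∧ B[r]? = some p ∧
      ∀ i, r < i → i < s → A[i]? ≠ some p := by
    obtain ⟨r, hr, hmax⟩ := Finset.exists_max_image
      ((Finset.Ico u s).filter fun r => A[r]? = some p ∨ B[r]? = some p) id (by
        obtain ⟨r, h1, h2, h3⟩ := hp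
        exact ⟨r, by simp [h1, h2, h3]⟩)
    simp only [Finset.mem_filter, Finset.mem_Ico, id] at hr hmax
    obtain ⟨h1, h2⟩ := hsame r hr.1.1 (by omega) hr.2
    refine ⟨r, hr.1.1, hr.1.2, h1, h2, fun i hi his hip => ?_⟩
    have := hmax i ⟨⟨by omega, his⟩, Or.inl hip⟩
    omega
  obtain ⟨r, hur, hrs, hA, hB, hno⟩ := hlast
  obtain ⟨i, hri, hie, hi⟩ := exists_request_in_batch hAB hs hrs.le hB
  have his : s ≤ i := by
    by_contra h
    exact hno i hri (by omega) hi
  obtain ⟨j, rfl⟩ := Nat.exists_eq_add_of_le his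
  apply hpR
  rw [List.mem_iff_getElem?]
  refine ⟨j, ?_⟩
  rcases batch_getElem? hAB (s := s) (i := j) (by omega) with h | ⟨rfl, h⟩
  · rw [h, hi]
  · rw [h]
    exact (hsame (s + 0) (by omega) (by omega) (Or.inl hi)).2

/-- Here `u` is the start of the previous batch, from which the pages of `C` stem, and `S` is the
competitor with initial cache `C'`. Write `E r` for `ell1From w A B r`, `e` for the end of the batch
and `S₁` for the part of `S` in it. The plan costs at most `w(C \ C') + cost S₁ + E s - E e`,
dropping stale pages at most `E u - E e`, and the caches then differ by at most `cost S₁ + E s - E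
e`. With the `3 E e + E s` of the remaining batches the error terms add up to `3 E s + E u`. -/
theorem cost_batchFrom_le {k : ℕ} {w : P → ℝ} (hw : ∀ p, 0 ≤ w p)
    {σ : Finset P → List P → List (Finset P)} (hσ : IsOptimalOffline k w σ) {A B : List P}
    (hAB : A.length = B.length) (fuel u s : ℕ) (C C' : Finset P) (S : List (Finset P))
    (hus : u ≤ s) (hs : s ≤ A.length)
    (hC : ∀ p ∈ C, ∃ r, u ≤ r ∧ r < s ∧ (A[r]? = some p ∨ B[r]? = some p))
    (hS : Serves k (B.drop s) S) :
    cost w C (batchFrom keepRequested σ (messages A B) fuel s C) ≤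
      ∑ p ∈ C \ C', w p + 2 * cost w C' S + 3 * ell1From w A B s + ell1From w A B u := by
  have hl := length_messages hAB
  induction fuel generalizing u s C C' S with
  | zero =>
    have h1 := Finset.sum_nonneg (s := C \ C') fun p _ => hw p
    have h2 := cost_nonneg hw C' S
    have h3 : 0 ≤ ell1From w A B s := ell1_nonneg hw _ _
    have h4 : 0 ≤ ell1From w A B u := ell1_nonneg hw _ _
    simp only [batchFrom, cost]
    linarith
  | succ fuel ih =>
    have hE (r) : 0 ≤ ell1From w A B r := ell1_nonneg hw _ _
    have hEu : ell1From w A B s ≤ ell1From w A B u := by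
      have := sum_le_ell1From_sub hw hAB (Y := ∅) hus (by simp)
      simpa using this
    rcases hs.eq_or_lt with rfl | hs
    · rw [batchFrom_of_length_le (by omega)]
      have h1 := Finset.sum_nonneg (s := C \ C') fun p _ => hw p
      have h2 := cost_nonneg hw C' S
      have h3 := hE u
      have h4 := hE A.length
      simp only [cost]
      linarith
    have hpos := length_batch_pos (M := messages A B) (s := s) (by omega)
    have hle := add_length_batch_le hAB hs
    have hbatch := ell1_batch_le hw hAB hs
    have hmem : ∀ p ∈ batch (messages A B) s, ∃ r, s ≤ r ∧
        r < s + (batch (messages A B) s).length ∧ (A[r]? = some p ∨ B[r]? = some p) := by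
      intro p hp
      obtain ⟨i, hi, hip⟩ := List.mem_iff_getElem.1 hp
      have hip' : (batch (messages A B) s)[i]? = some p := by
        rw [List.getElem?_eq_getElem hi, hip]
      refine ⟨s + i, by omega, by omega, ?_⟩
      rw [← hip', eq_comm, @eq_comm _ B[s + i]?]
      exact (batch_getElem? hAB hi).imp id And.right
    have herr := fun h p => exists_error_of_notMem_batch hAB (u := u) (s := s) h (p := p)
    rw [batchFrom, if_pos (by omega), hσ.length_eq, cost_append]
    set R := batch (messages A B) s with hR
    obtain ⟨hX1, hX2, hX3⟩ := hσ C R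
    set X := σ C R with hX
    obtain ⟨S₁, S₂, rfl, hS₁, hS₂⟩ : ∃ S₁ S₂, S = S₁ ++ S₂ ∧
        Serves k ((B.drop s).take R.length) S₁ ∧ Serves k (B.drop (s + R.length)) S₂ := by
      refine ⟨S.take R.length, S.drop R.length, (List.take_append_drop _ _).symm,
        List.forall₂_take _ hS, ?_⟩
      rw [← List.drop_drop]
      exact List.forall₂_drop _ hS
    have hRl : R.length = ((B.drop s).take R.length).length := by simp; omega
    rw [cost_append w C']
    obtain ⟨S', hS', hgap⟩ := hS₁.exists_gap_le hw hRl
    have hcost : cost w C X ≤ ∑ p ∈ C \ C', w p + cost w C' S₁ +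
        (ell1From w A B s - ell1From w A B (s + R.length)) := by
      have h1 := hX3 S' hS'
      have h2 := cost_le_cost_add_gap hw (hS₁.length_eq.symm.trans (hRl.symm.trans
        hS'.length_eq)) C' C
      linarith
    -- After the last batch no pages need to be dropped; there, a page may be absent merely because
    -- it is never requested again.
    rcases hle.eq_or_lt with he | he
    · rw [batchFrom_of_length_le (by omega), cost]
      have h1 := hE (s + R.length)
      have h2 := cost_nonneg hw C' S₁
      have h3 := cost_nonneg hw (S₁.getLastD C') S₂
      have h4 := hE s
      linarith
    have hrest := ih s (s + R.length) (keepRequested R (X.getLastD C)) (S₁.getLastD C') S₂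
      (by omega) he.le (fun p hp => hmem p (by simpa using (Finset.mem_inter.1 hp).2)) hS₂
    have hkeep : ∑ p ∈ keepRequested R (X.getLastD C) \ S₁.getLastD C', w p ≤
        cost w C' S₁ + (ell1From w A B s - ell1From w A B (s + R.length)) := by
      refine le_trans (Finset.sum_le_sum_of_subset_of_nonneg
        (Finset.sdiff_subset_sdiff Finset.inter_subset_right subset_rfl) fun p _ _ => hw p)
        ((hS₁.sum_toFinset_sdiff_le hw hRl C').trans (by linarith))
    have hdrop : ∑ p ∈ X.getLastD C \ keepRequested R (X.getLastD C), w p ≤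
        ell1From w A B u - ell1From w A B (s + R.length) := by
      apply sum_le_ell1From_sub hw hAB (by omega)
      intro p hp
      simp only [keepRequested, Finset.mem_sdiff, Finset.mem_inter, List.mem_toFinset,
        not_and] at hp
      -- An on-demand plan fetches only requested pages, so an unrequested page was there from the
      -- start.
      have hpC : p ∈ C := by
        have := hX2.getLastD_subset hX1.length_eq hp.1
        simp only [Finset.mem_union, List.mem_toFinset] at this
        exact this.resolve_right (hp.2 hp.1)
      obtain ⟨r, a, b, h1, h2, h3⟩ := herr he p (hC p hpC) (hp.2 hp.1)
      exact ⟨r, a, b, h1, by omega, h3⟩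
    -- The remaining schedule is charged from the untrimmed cache; starting it from the trimmed one
    -- instead changes the cost by at most the weight in `hdrop`.
    have htri := cost_le_add_cost hw (batchFrom keepRequested σ (messages A B) fuel
      (s + R.length) (keepRequested R (X.getLastD C))) (keepRequested R (X.getLastD C))
      (X.getLastD C)
    linarith

/-- With correct predictions, all pages that were requested occur in the next batch, unless it is
the last one. -/
theorem staticFrom_eq_keepRequested {k : ℕ} {w : P → ℝ}
    {σ : Finset P → List P → List (Finset P)} (hσ : IsOptimalOffline k w σ) (A : List P)
    (fuel s : ℕ) (C : Finset P) (hs : s ≤ A.length)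
    (hC : ∀ p ∈ C, ∃ r, r < s ∧ A[r]? = some p) :
    staticFrom σ (messages A A) fuel s C =
      batchFrom keepRequested σ (messages A A) fuel s C := by
  rw [staticFrom_eq_batchFrom]
  have hl := length_messages (rfl : A.length = A.length)
  induction fuel generalizing s C with
  | zero => rfl
  | succ fuel ih =>
    rcases hs.eq_or_lt with rfl | hs
    · rw [batchFrom_of_length_le (by omega), batchFrom_of_length_le (by omega)]
    rw [batchFrom, batchFrom, if_pos (by omega), if_pos (by omega), hσ.length_eq]
    congr 1
    rcases (add_length_batch_le rfl hs).eq_or_lt with he | he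
    · rw [batchFrom_of_length_le (by omega), batchFrom_of_length_le (by omega)]
    have hlast := (hσ C (batch (messages A A) s)).2.1.getLastD_subset
      (hσ.length_eq C _).symm
    have hCR : C ⊆ (batch (messages A A) s).toFinset := by
      intro p hp
      by_contra hpR
      obtain ⟨r, hr, hr'⟩ := hC p hp
      obtain ⟨r, a, b, -, -, ha, hb, hab, -⟩ := exists_error_of_notMem_batch rfl (u := 0) he
        ⟨r, by omega, hr, Or.inl hr'⟩ (by simpa using hpR)
      rw [ha, Option.some.injEq] at hb
      exact hab hb
    rw [Finset.union_eq_right.2 hCR] at hlast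
    have hkeep : keepRequested (batch (messages A A) s)
        ((σ C (batch (messages A A) s)).getLastD C) =
          (σ C (batch (messages A A) s)).getLastD C := Finset.inter_eq_left.2 hlast
    rw [hkeep]
    apply ih _ _ he.le
    intro p hp
    obtain ⟨i, hi, hip⟩ := List.mem_iff_getElem.1 (List.mem_toFinset.1 (hlast hp))
    refine ⟨s + i, by omega, ?_⟩
    rw [← hip, ← List.getElem?_eq_getElem hi, eq_comm]
    exact (batch_getElem? rfl hi).elim id And.right

/-! ### The algorithm `STATIC` -/

theorem list_map_range_eq {α : Type*} {l : List α} {n : ℕ} (hn : l.length = n) {f : ℕ → α}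
    (h : ∀ i < n, l[i]? = some (f i)) : (List.range n).map f = l := by
  apply List.ext_getElem?
  intro i
  rcases lt_or_ge i n with hi | hi
  · rw [h i hi, List.getElem?_map, List.getElem?_range hi, Option.map_some]
  · rw [List.getElem?_eq_none (by simpa), List.getElem?_eq_none (by omega)]

theorem length_batchFrom {k : ℕ} {w : P → ℝ} {next : List P → Finset P → Finset P}
    (hnext : ∀ R C, next R C ⊆ C)
    {σ : Finset P → List P → List (Finset P)} (hσ : IsOptimalOffline k w σ) {A B : List P}
    (hAB : A.length = B.length) :
    (batchFrom next σ (messages A B) A.length 0 ∅).length = A.length := by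
  obtain ⟨R, h1, -, h3, -⟩ := batchFrom_serves hnext hσ hAB A.length 0 ∅ (by omega) (by omega)
  rw [← h3.length_eq, h1, Nat.sub_zero]

/-- This makes the batch schedule an online algorithm: its entry at time `t` can be computed from
the first `t + 1` messages. -/
theorem batchFrom_getElem? {k : ℕ} {w : P → ℝ} {next : List P → Finset P → Finset P}
    (hnext : ∀ R C, next R C ⊆ C)
    {σ : Finset P → List P → List (Finset P)} (hσ : IsOptimalOffline k w σ) {A B : List P}
    (hAB : A.length = B.length) {t : ℕ} (ht : t < A.length) :
    (batchFrom next σ (messages A B) A.length 0 ∅)[t]? =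
      some ((batchFrom next σ ((messages A B).take (t + 1)) (t + 1) 0 ∅).getD t ∅) := by
  have hl := length_messages hAB
  rw [List.getD_eq_getElem?_getD, batchFrom_take hσ.length_eq (M := messages A B) (j := t + 1)
    (by omega) (t + 1) A.length 0 t ∅ (by omega) (by omega) (by omega),
    List.getElem?_eq_getElem (by rw [length_batchFrom hnext hσ hAB]; exact ht),
    Option.getD_some]

theorem static_schedule {k : ℕ} {w : P → ℝ} {σ : Finset P → List P → List (Finset P)}
    (hσ : IsOptimalOffline k w σ) (A : List P) :
    (List.range A.length).map (fun t => static σ ((messages A A).take (t + 1))) =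
      staticFrom σ (messages A A) A.length 0 ∅ := by
  have hl := length_messages (rfl : A.length = A.length)
  rw [staticFrom_eq_batchFrom]
  apply list_map_range_eq (length_batchFrom (fun _ _ => subset_rfl) hσ rfl)
  intro t ht
  rw [batchFrom_getElem? (fun _ _ => subset_rfl) hσ rfl ht, static, staticFrom_eq_batchFrom,
    List.length_take, hl, min_eq_left (by omega), Nat.add_sub_cancel]

theorem static_serves {k : ℕ} {w : P → ℝ} {σ : Finset P → List P → List (Finset P)}
    (hσ : IsOptimalOffline k w σ) (A : List P) :
    Serves k A (staticFrom σ (messages A A) A.length 0 ∅) ∧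
      OnDemand ∅ A (staticFrom σ (messages A A) A.length 0 ∅) := by
  rw [staticFrom_eq_batchFrom]
  obtain ⟨R, h1, h2, h3, h4⟩ := batchFrom_serves (fun _ _ => subset_rfl) hσ
    (rfl : A.length = A.length) A.length 0 ∅ (by omega) (by omega)
  obtain rfl : R = A := by
    apply List.ext_getElem?
    intro i
    rcases lt_or_ge i R.length with hi | hi
    · simpa using h2 i hi
    · rw [List.getElem?_eq_none hi, List.getElem?_eq_none (by omega)]
  exact ⟨h3, h4⟩

/-- `STATIC` is 2-competitive. -/
theorem cost_static_le {k : ℕ} {w : P → ℝ} (hw : ∀ p, 0 ≤ w p)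
    {σ : Finset P → List P → List (Finset P)} (hσ : IsOptimalOffline k w σ) {A : List P}
    {S : List (Finset P)} (hS : Serves k A S) :
    cost w ∅ (staticFrom σ (messages A A) A.length 0 ∅) ≤ 2 * cost w ∅ S := by
  rw [staticFrom_eq_keepRequested hσ A _ _ _ (by omega) (by simp)]
  have := cost_batchFrom_le hw hσ (rfl : A.length = A.length) A.length 0 0 ∅ ∅ S le_rfl
    (by omega) (by simp) (by simpa using hS)
  simpa [ell1From, ell1_self] using this

/-! ### The algorithm `FOLLOW` -/

/-- Imitation of the schedule `S` when the page `p` is replaced by `π p`, from a time on from which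
the predictions and requests are given by the list. -/
def followFrom : (π : P → P) → List (P × P) → List (Finset P) → List (Finset P)
  | π, x :: AB, D :: S =>
    D.image (Function.update π x.1 x.2) :: followFrom (Function.update π x.1 x.2) AB S
  | _, _, _ => []

theorem partner_append (H : List (P × P)) (x : P × P) :
    partner (H ++ [x]) = Function.update (partner H) x.1 x.2 := by
  funext p
  rw [partner, List.reverse_append, List.reverse_singleton, List.singleton_append,
    List.find?_cons, Function.update_apply]
  by_cases h : x.1 = p
  · simp [h]
  · simp [h, Ne.symm h, partner]

theorem map_image_partner (H AB : List (P × P)) (S : ℕ → Finset P) :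
    (List.range AB.length).map (fun t => (S t).image (partner (H ++ AB.take (t + 1)))) =
      followFrom (partner H) AB ((List.range AB.length).map S) := by
  induction AB generalizing H S with
  | nil => rfl
  | cons x AB ih =>
    have := ih (H ++ [x]) fun t => S (t + 1)
    simp only [List.length_cons, List.range_succ_eq_map, List.map_cons, List.map_map, followFrom,
      List.take_succ_cons, List.take_zero, partner_append, List.append_assoc,
      List.singleton_append, Function.comp_def, Nat.succ_eq_add_one] at this ⊢
    rw [this]

theorem follow_eq {k : ℕ} {w : P → ℝ} {σ : Finset P → List P → List (Finset P)}
    (hσ : IsOptimalOffline k w σ) {A B : List P} (hAB : A.length = B.length) :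
    follow σ A B =
      followFrom (partner []) (A.zip B) (staticFrom σ (messages A A) A.length 0 ∅) := by
  have hl : (A.zip B).length = A.length := by simp [hAB]
  have := map_image_partner [] (A.zip B) fun t => static σ ((messages A A).take (t + 1))
  rw [hl, static_schedule hσ] at this
  rw [← this, follow, hAB]
  rfl

theorem followFrom_serves {k : ℕ} {A B : List P} (hAB : A.length = B.length)
    {S : List (Finset P)} (hS : Serves k A S) (π : P → P) :
    Serves k B (followFrom π (A.zip B) S) := by
  induction hS generalizing B π with
  | nil =>
    obtain rfl := List.length_eq_zero_iff.1 hAB.symm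
    exact List.Forall₂.nil
  | @cons a D A S hD hS ih =>
    obtain _ | ⟨b, B⟩ := B
    · simp at hAB
    refine List.Forall₂.cons ⟨?_, Finset.card_image_le.trans hD.2⟩
      (ih (by simpa using hAB) _)
    exact Finset.mem_image.2 ⟨a, hD.1, by simp⟩

theorem le_add_starDist {w : P → ℝ} (hw : ∀ p, 0 ≤ w p) (a b : P) :
    w b ≤ w a + starDist w a b := by
  unfold starDist
  split_ifs with h
  · simp [h]
  · linarith [hw a]

theorem sum_image_le {w : P → ℝ} (hw : ∀ p, 0 ≤ w p) (C : Finset P) (π : P → P) :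
    ∑ p ∈ C.image π, w p ≤ ∑ p ∈ C, w (π p) := by
  induction C using Finset.induction_on with
  | empty => simp
  | insert a C ha ih =>
    rw [Finset.image_insert, Finset.sum_insert ha]
    refine (sum_le_of_subset_union hw (D := {π a}) (E := C.image π) ?_).trans
      (by simpa using ih)
    rw [Finset.insert_eq]

/-- Amortization with the potential `∑ p ∈ C, starDist w p (π p)`. If `p` is evicted, so may be `π
p`, of weight at most `w p + starDist w p (π p)`, and the potential of `p` is released. If `a` stays
but changes its partner, the loss of `π a` is paid by the old potential of `a` and one `starDist w a
b`; the other one is the new potential of `a`. On-demand fetching ensures that no other page brings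
in new potential. -/
theorem follow_step_le {w : P → ℝ} (hw : ∀ p, 0 ≤ w p) {C D : Finset P} {a : P} (b : P)
    (ha : a ∈ D) (hD : D ⊆ insert a C) (π : P → P) :
    ∑ p ∈ C.image π \ D.image (Function.update π a b), w p +
        ∑ p ∈ D, starDist w p (Function.update π a b p) ≤
      ∑ p ∈ C \ D, w p + ∑ p ∈ C, starDist w p (π p) + 2 * starDist w a b := by
  have hd := starDist_nonneg hw
  have h1 : ∑ p ∈ D, starDist w p (Function.update π a b p) =
      starDist w a b + ∑ p ∈ D.erase a, starDist w p (π p) := by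
    rw [← Finset.add_sum_erase D _ ha, Function.update_self]
    congr 1
    refine Finset.sum_congr rfl fun p hp => ?_
    rw [Function.update_of_ne (Finset.ne_of_mem_erase hp)]
  have hsub : D.erase a ⊆ C := fun p hp => by
    have := hD (Finset.mem_of_mem_erase hp)
    rw [Finset.mem_insert] at this
    exact this.resolve_left (Finset.ne_of_mem_erase hp)
  have h2 : ∑ p ∈ C, starDist w p (π p) =
      ∑ p ∈ C \ D.erase a, starDist w p (π p) + ∑ p ∈ D.erase a, starDist w p (π p) :=
    (Finset.sum_sdiff hsub).symm
  have h3 : ∑ p ∈ C.image π \ D.image (Function.update π a b), w p ≤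
      ∑ p ∈ C \ D, w p + ∑ p ∈ C \ D.erase a, starDist w p (π p) + starDist w a b := by
    have hCD : ∑ p ∈ C \ D, w (π p) ≤ ∑ p ∈ C \ D, w p + ∑ p ∈ C \ D, starDist w p (π p) := by
      rw [← Finset.sum_add_distrib]
      exact Finset.sum_le_sum fun p _ => le_add_starDist hw p (π p)
    have hmem : ∀ x ∈ C.image π \ D.image (Function.update π a b),
        x ∈ (C \ D).image π ∨ a ∈ C ∧ x = π a ∧ π a ≠ b := by
      intro x hx
      rw [Finset.mem_sdiff, Finset.mem_image] at hx
      obtain ⟨⟨p, hp, rfl⟩, hx⟩ := hx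
      by_cases hpa : p = a
      · subst hpa
        refine Or.inr ⟨hp, rfl, fun h => hx ?_⟩
        exact Finset.mem_image.2 ⟨p, ha, by simp [h]⟩
      · refine Or.inl (Finset.mem_image_of_mem _ (Finset.mem_sdiff.2 ⟨hp, fun h => hx ?_⟩))
        exact Finset.mem_image.2 ⟨p, h, by simp [hpa]⟩
    by_cases hC : a ∈ C ∧ π a ≠ b
    · have h4 : ∑ p ∈ C.image π \ D.image (Function.update π a b), w p ≤
          ∑ p ∈ (C \ D).image π, w p + ∑ p ∈ {π a}, w p :=
        sum_le_of_subset_union hw fun x hx => by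
          rw [Finset.mem_union, Finset.mem_singleton]
          exact (hmem x hx).imp id fun h => h.2.1
      have h5 : C \ D.erase a = insert a (C \ D) := by
        ext p
        simp only [Finset.mem_sdiff, Finset.mem_erase, Finset.mem_insert]
        have := hC.1
        by_cases hpa : p = a
        · subst hpa; tauto
        · tauto
      have h6 : w (π a) ≤ starDist w a (π a) + starDist w a b := by
        by_cases hπ : π a = a
        · rw [hπ] at hC ⊢
          simp only [starDist, hC.2, if_true, if_false]
          linarith [hw b]
        · have := hd a b
          simp only [starDist, Ne.symm hπ, if_false] at this ⊢
          linarith [hw a]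
      rw [h5, Finset.sum_insert (by simp [ha])]
      rw [Finset.sum_singleton] at h4
      have h7 := sum_image_le hw (C \ D) π
      linarith
    · have h4 : ∑ p ∈ C.image π \ D.image (Function.update π a b), w p ≤
          ∑ p ∈ (C \ D).image π, w p :=
        Finset.sum_le_sum_of_subset_of_nonneg (fun x hx => (hmem x hx).resolve_right fun h =>
          hC ⟨h.1, h.2.2⟩) fun p _ _ => hw p
      have h5 : ∑ p ∈ C \ D, starDist w p (π p) ≤ ∑ p ∈ C \ D.erase a, starDist w p (π p) :=
        Finset.sum_le_sum_of_subset_of_nonneg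
          (Finset.sdiff_subset_sdiff subset_rfl (Finset.erase_subset a D)) fun p _ _ => hd _ _
      have h7 := sum_image_le hw (C \ D) π
      have := hd a b
      linarith
  linarith

theorem cost_followFrom_le {w : P → ℝ} (hw : ∀ p, 0 ≤ w p) {k : ℕ} {A B : List P}
    (hAB : A.length = B.length) {S : List (Finset P)} (hS : Serves k A S) (C : Finset P)
    (hD : OnDemand C A S) (π : P → P) :
    cost w (C.image π) (followFrom π (A.zip B) S) ≤
      cost w C S + 2 * ell1 w A B + ∑ p ∈ C, starDist w p (π p) := by
  induction hS generalizing B C π with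
  | nil =>
    obtain rfl := List.length_eq_zero_iff.1 hAB.symm
    simpa [followFrom, cost] using Finset.sum_nonneg fun p _ => starDist_nonneg hw p (π p)
  | @cons a D A S hD' hS ih =>
    obtain _ | ⟨b, B⟩ := B
    · simp at hAB
    have h1 := ih (B := B) (by simpa using hAB) D hD.2 (Function.update π a b)
    have h2 := follow_step_le hw b hD'.1 hD.1 π
    rw [List.zip_cons_cons, followFrom, cost, cost, ell1_cons]
    linarith

theorem follow_serves_and_cost_le {w : P → ℝ} (hw : ∀ p, 0 ≤ w p) {k : ℕ} (hk : 1 ≤ k)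
    {σ : Finset P → List P → List (Finset P)} (hσ : IsOptimalOffline k w σ) {A B : List P}
    (hAB : A.length = B.length) :
    Serves k B (follow σ A B) ∧
      cost w ∅ (follow σ A B) ≤ 4 * (opt k w B + ell1 w A B) := by
  rw [follow_eq hσ hAB]
  obtain ⟨hS, hD⟩ := static_serves hσ A
  refine ⟨followFrom_serves hAB hS _, ?_⟩
  have h1 := cost_followFrom_le hw hAB hS ∅ hD (partner [])
  rw [Finset.image_empty, Finset.sum_empty] at h1
  have h0 := ell1_nonneg hw A B
  -- `STATIC` pays at most twice the cost of a competitor transferred to `A`, that is `2 (cost S +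
  -- ℓ₁)`, and the imitation adds `2 ℓ₁`.
  have h2 : (cost w ∅ (followFrom (partner []) (A.zip B)
      (staticFrom σ (messages A A) A.length 0 ∅)) - 4 * ell1 w A B) / 2 ≤ opt k w B := by
    apply le_opt hk
    intro S hS
    obtain ⟨S', hS', hgap⟩ := hS.exists_gap_le hw hAB
    have h2 := cost_le_cost_add_gap hw (hS.length_eq.symm.trans (hAB.symm.trans hS'.length_eq))
      ∅ ∅
    have h3 := cost_static_le hw hσ hS'
    rw [Finset.sdiff_self, Finset.sum_empty] at h2
    linarith
  have h3 : 0 ≤ opt k w B := le_opt hk fun S _ => cost_nonneg hw _ _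
  linarith

/-! ### An online algorithm -/

/-- Remove a page of minimum weight. -/
noncomputable def eraseLightest (w : P → ℝ) (C : Finset P) : Finset P :=
  if h : C.Nonempty then C.erase (C.exists_min_image w h).choose else C

theorem eraseLightest_spec (w : P → ℝ) {C : Finset P} {p : P} (hp : p ∈ C) :
    ∃ q ∈ C, w q ≤ w p ∧ eraseLightest w C = C.erase q := by
  have h : C.Nonempty := ⟨p, hp⟩
  refine ⟨(C.exists_min_image w h).choose, (C.exists_min_image w h).choose_spec.1,
    (C.exists_min_image w h).choose_spec.2 p hp, ?_⟩
  rw [eraseLightest, dif_pos h]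

/-- Make sure that the page `b` is in the cache. -/
noncomputable def force (w : P → ℝ) (b : P) (C : Finset P) : Finset P :=
  if b ∈ C then C else insert b (eraseLightest w C)

/-- The planned cache contains `a`, so its lightest page weighs at most `w a`, and giving it up for
`b` costs no more than giving up `a`. -/
theorem force_serves {w : P → ℝ} (hw : ∀ p, 0 ≤ w p) {k : ℕ} {A B : List P}
    {S : List (Finset P)} (hAB : A.length = B.length) (hS : Serves k A S) :
    Serves k B (List.zipWith (force w) B S) ∧
      gap w S (List.zipWith (force w) B S) ≤ ell1 w A B := by
  induction hS generalizing B with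
  | nil =>
    obtain rfl := List.length_eq_zero_iff.1 hAB.symm
    exact ⟨List.Forall₂.nil, by simp [gap]⟩
  | @cons a D A S hD hS ih =>
    obtain _ | ⟨b, B⟩ := B
    · simp at hAB
    obtain ⟨h1, h2⟩ := ih (B := B) (by simpa using hAB)
    rw [List.zipWith_cons_cons, ell1_cons]
    simp only [gap, List.zipWith_cons_cons, List.sum_cons] at h2 ⊢
    by_cases hb : b ∈ D
    · rw [force, if_pos hb]
      refine ⟨List.Forall₂.cons ⟨hb, hD.2⟩ h1, ?_⟩
      have := starDist_nonneg hw a b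
      simp only [Finset.sdiff_self, Finset.sum_empty]
      linarith
    · have hab : a ≠ b := fun h => hb (h ▸ hD.1)
      obtain ⟨q, hq, hqa, he⟩ := eraseLightest_spec w hD.1
      rw [force, if_neg hb, he]
      refine ⟨List.Forall₂.cons ⟨by simp, ?_⟩ h1, ?_⟩
      · refine (Finset.card_insert_le _ _).trans ?_
        rw [Finset.card_erase_of_mem hq]
        have := Finset.card_pos.2 ⟨q, hq⟩
        have := hD.2
        omega
      · have h3 : ∑ p ∈ D \ insert b (D.erase q), w p ≤ ∑ p ∈ {q}, w p :=
          Finset.sum_le_sum_of_subset_of_nonneg (fun p => by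
            simp only [Finset.mem_sdiff, Finset.mem_insert, Finset.mem_erase,
              Finset.mem_singleton]; tauto) fun p _ _ => hw p
        have h4 : ∑ p ∈ insert b (D.erase q) \ D, w p ≤ ∑ p ∈ {b}, w p :=
          Finset.sum_le_sum_of_subset_of_nonneg (fun p => by
            simp only [Finset.mem_sdiff, Finset.mem_insert, Finset.mem_erase,
              Finset.mem_singleton]; tauto) fun p _ _ => hw p
        simp only [Finset.sum_singleton] at h3 h4
        simp only [starDist, hab, if_false]
        linarith

/-- Follow the plan for a batch of predicted requests, forcing the actual requests into the cache;
at the end of a batch drop the pages that were not to be requested in it. -/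
noncomputable def batchAlgorithm (w : P → ℝ) (σ : Finset P → List P → List (Finset P)) :
    Algorithm P := fun M =>
  let C := (batchFrom keepRequested σ M M.length 0 ∅).getD (M.length - 1) ∅
  (M.getLast?.map fun m => force w m.1 C).getD C

theorem messages_getElem?_fst {A B : List P} (hAB : A.length = B.length) (t : ℕ) :
    (messages A B)[t]?.map Prod.fst = B[t]? := by
  induction A generalizing B t with
  | nil =>
    obtain rfl := List.length_eq_zero_iff.1 hAB.symm
    simp [messages]
  | cons a A ih =>
    obtain _ | ⟨b, B⟩ := B
    · simp at hAB
    · cases t with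
      | zero => simp [messages]
      | succ t => simpa [messages] using ih (B := B) (by simpa using hAB) t

/-- Forcing never feeds back into the plan, so it acts on each entry separately. -/
theorem batchAlgorithm_run {k : ℕ} {w : P → ℝ}
    {σ : Finset P → List P → List (Finset P)} (hσ : IsOptimalOffline k w σ) {A B : List P}
    (hAB : A.length = B.length) :
    (batchAlgorithm w σ).run (messages A B) =
      List.zipWith (force w) B (batchFrom keepRequested σ (messages A B) A.length 0 ∅) := by
  have hl := length_messages hAB
  have hnext : ∀ (R : List P) (C : Finset P), keepRequested R C ⊆ C :=
    fun R C => Finset.inter_subset_left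
  have hlen := length_batchFrom hnext hσ hAB
  apply list_map_range_eq
  · rw [List.length_zipWith, hlen, hl, hAB, min_self]
  · intro t ht
    have htB : t < B.length := by omega
    rw [List.getElem?_zipWith, batchFrom_getElem? hnext hσ hAB (by omega),
      List.getElem?_eq_getElem htB]
    have hlast : (((messages A B).take (t + 1)).getLast?).map Prod.fst = some B[t] := by
      rw [List.getLast?_take, if_neg (by omega), Nat.add_sub_cancel,
        List.getElem?_eq_getElem (by omega), Option.some_or, ← List.getElem?_eq_getElem,
        messages_getElem?_fst hAB, List.getElem?_eq_getElem htB]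
    obtain ⟨m, hm, hm'⟩ := Option.map_eq_some_iff.1 hlast
    simp only [batchAlgorithm, hm, Option.map_some, Option.getD_some, hm', List.length_take, hl]
    rw [min_eq_left (by omega), Nat.add_sub_cancel]

theorem batchAlgorithm_serves_and_cost_le {w : P → ℝ} (hw : ∀ p, 0 ≤ w p) {k : ℕ} (hk : 1 ≤ k)
    {σ : Finset P → List P → List (Finset P)} (hσ : IsOptimalOffline k w σ) {A B : List P}
    (hAB : A.length = B.length) :
    Serves k B ((batchAlgorithm w σ).run (messages A B)) ∧
      (batchAlgorithm w σ).cost w A B ≤ 5 * (opt k w B + ell1 w A B) := by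
  have hnext : ∀ (R : List P) (C : Finset P), keepRequested R C ⊆ C :=
    fun R C => Finset.inter_subset_left
  rw [Algorithm.cost, batchAlgorithm_run hσ hAB]
  obtain ⟨R, h1, h2, h3, -⟩ := batchFrom_serves hnext hσ hAB A.length 0 ∅ (by omega) (by omega)
  have hRB : R.length = B.length := by omega
  obtain ⟨hF, hgap⟩ := force_serves hw hRB h3
  refine ⟨hF, ?_⟩
  have h4 : ell1 w R B ≤ ell1 w A B :=
    ell1_le_of_forall hw hRB hAB fun i hi => by simpa using h2 i (by omega)
  have h5 := cost_le_cost_add_gap hw (h3.length_eq.symm.trans (hRB.trans hF.length_eq)) ∅ ∅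
  rw [Finset.sdiff_self, Finset.sum_empty] at h5
  have h0 : 0 ≤ opt k w B := le_opt hk fun S _ => cost_nonneg hw _ _
  -- The plan costs `2 cost S + 4 ℓ₁`, and forcing adds `ℓ₁`.
  have h6 : (cost w ∅ (List.zipWith (force w) B
      (batchFrom keepRequested σ (messages A B) A.length 0 ∅)) - 5 * ell1 w A B) / 2 ≤
        opt k w B := by
    apply le_opt hk
    intro S hS
    have := cost_batchFrom_le hw hσ hAB A.length 0 0 ∅ ∅ S le_rfl (by omega) (by simp)
      (by simpa using hS)
    simp only [ell1From, List.drop_zero, Finset.sdiff_self, Finset.sum_empty] at this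
    linarith
  linarith

/-! ### An adversary -/

/-- The sum of `m H b` over all requests `b` of a sequence, where `H` are the requests before. -/
def missSum {P : Type*} (m : List P → P → ℝ) : List P → List P → ℝ
  | _, [] => 0
  | H, b :: B => m H b + missSum m (H ++ [b]) B

theorem missSum_append_singleton {P : Type*} (m : List P → P → ℝ) (H B : List P) (b : P) :
    missSum m H (B ++ [b]) = missSum m H B + m (H ++ B) b := by
  induction B generalizing H with
  | nil => simp [missSum]
  | cons a B ih => simp [missSum, ih, add_assoc]

theorem cost_one_singleton (C D : Finset P) :
    cost (fun _ => (1 : ℝ)) C [D] = ((C \ D).card : ℝ) := by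
  simp [cost]

theorem cost_append_pair_self (w : P → ℝ) (C D : Finset P) (S : List (Finset P)) :
    cost w C ((S ++ [D]) ++ [D]) = cost w C (S ++ [D]) := by
  rw [cost_append w C (S ++ [D])]
  simp [cost]

/-- If at any time there is a marked page that is missed with weight `c` or an unmarked one that is
missed with weight `θ j`, where `j` is the number of unmarked pages, then there is an expensive
request sequence for which `OPT` pays only once for marking `k` pages. -/
theorem exists_adversary {k : ℕ} (hk : 1 ≤ k) {U : Finset P} (hU : U.card = k + 1) {T : ℕ}
    {m : List P → P → ℝ} {c : ℝ} (hc : 0 ≤ c) {θ : ℕ → ℝ}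
    (hθ : ∀ j, 1 ≤ j → j ≤ k + 1 → c ≤ θ j)
    (h : ∀ H : List P, H.length < T → ∀ S ⊆ U, S.Nonempty →
      ∃ q ∈ U, (q ∉ S ∧ c ≤ m H q) ∨ (q ∈ S ∧ θ S.card ≤ m H q)) :
    ∃ B : List P, B.length = T ∧ (∀ b ∈ B, b ∈ U) ∧ ∃ p : ℕ, opt k (fun _ => 1) B ≤ p ∧
      c * T ≤ missSum m [] B ∧ p * ∑ j ∈ Finset.Ioc 0 k, θ j ≤ missSum m [] B := by
  -- `S` is the set of unmarked pages of the current phase and `p` the number of completed phases.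
  -- The offline player keeps its options open: any `D` of size `k` containing the marked pages can
  -- be its final cache at cost `p`, so it pays nothing during a phase.
  have key : ∀ t ≤ T, ∃ B : List P, B.length = t ∧ (∀ b ∈ B, b ∈ U) ∧
      ∃ (p : ℕ) (S : Finset P), S ⊆ U ∧ S.Nonempty ∧ c * t ≤ missSum m [] B ∧
        p * ∑ j ∈ Finset.Ioc 0 k, θ j + ∑ j ∈ Finset.Ioc S.card k, θ j ≤ missSum m [] B ∧
        ∀ D ⊆ U, D.card = k → U \ S ⊆ D → ∃ Z, Serves k B Z ∧
          cost (fun _ => (1 : ℝ)) ∅ (Z ++ [D]) ≤ p := by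
    intro t ht
    induction t with
    | zero =>
      refine ⟨[], rfl, by simp, 0, U, subset_rfl, ?_, by simp [missSum], by simp [missSum, hU],
        fun D _ _ _ => ⟨[], List.Forall₂.nil, by simp [cost]⟩⟩
      exact Finset.card_pos.1 (by omega)
    | succ t ih =>
      obtain ⟨B, hB, hBU, p, S, hSU, hS, h1, h2, h3⟩ := ih (by omega)
      have hScard := Finset.card_pos.2 hS
      have hScard' := (Finset.card_le_card hSU).trans_eq hU
      have hlen (q : P) : (B ++ [q]).length = t + 1 := by simp [hB]
      have hmem {q : P} (hq : q ∈ U) : ∀ b ∈ B ++ [q], b ∈ U := by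
        intro b hb
        rw [List.mem_append, List.mem_singleton] at hb
        rcases hb with hb | rfl
        exacts [hBU b hb, hq]
      have hserve {q : P} {D : Finset P} (hq : q ∈ D) (hD : D.card = k) {Z : List (Finset P)}
          (hZ : Serves k B Z) : Serves k (B ++ [q]) (Z ++ [D]) :=
        List.rel_append hZ (List.Forall₂.cons ⟨hq, hD.le⟩ List.Forall₂.nil)
      obtain ⟨q, hqU, ⟨hqS, hq⟩ | ⟨hqS, hq⟩⟩ := h B (by omega) S hSU hS
      · refine ⟨B ++ [q], hlen q, hmem hqU, p, S, hSU, hS, ?_, ?_, fun D hDU hD hSD => ?_⟩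
        · rw [missSum_append_singleton, List.nil_append]
          push_cast
          linarith
        · rw [missSum_append_singleton, List.nil_append]
          linarith
        · obtain ⟨Z, hZ, hZc⟩ := h3 D hDU hD hSD
          exact ⟨Z ++ [D], hserve (hSD (Finset.mem_sdiff.2 ⟨hqU, hqS⟩)) hD hZ,
            (cost_append_pair_self _ _ _ _).trans_le hZc⟩
      · have hcθ := hθ S.card hScard hScard'
        have hcT : c * ((t + 1 : ℕ) : ℝ) ≤ missSum m [] (B ++ [q]) := by
          rw [missSum_append_singleton, List.nil_append]
          push_cast
          linarith
        -- Requesting the last unmarked page `q` ends the phase and makes `q` the only marked page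
        -- of the next. The offline player has held `U.erase q` and moves to any `D` containing `q`
        -- at cost 1.
        rcases Nat.eq_or_lt_of_le hScard with hS1 | hS1
        · obtain rfl : S = {q} := by
            obtain ⟨x, rfl⟩ := Finset.card_eq_one.1 hS1.symm
            rw [Finset.mem_singleton.1 hqS]
          have hUq : (U.erase q).card = k := by rw [Finset.card_erase_of_mem hqU, hU]; rfl
          refine ⟨B ++ [q], hlen q, hmem hqU, p + 1, U.erase q, Finset.erase_subset _ _,
            Finset.card_pos.1 (by omega), hcT, ?_, fun D hDU hD hSD => ?_⟩
          · rw [missSum_append_singleton, List.nil_append, hUq, Finset.Ioc_self,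
              Finset.sum_empty]
            have h4 : ∑ j ∈ Finset.Ioc 0 k, θ j = θ 1 + ∑ j ∈ Finset.Ioc 1 k, θ j := by
              rw [Finset.add_sum_Ioc_eq_sum_Icc hk]
              rfl
            rw [Finset.card_singleton] at h2 hq
            push_cast
            rw [add_mul, one_mul]
            linarith
          · obtain ⟨Z, hZ, hZc⟩ := h3 (U.erase q) (Finset.erase_subset _ _) hUq (by
              rw [Finset.sdiff_singleton_eq_erase])
            have hqD : q ∈ D := hSD (by simp [hqU])
            refine ⟨Z ++ [D], hserve hqD hD hZ, ?_⟩
            rw [cost_append_pair_self]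
            rw [cost_append, cost_one_singleton] at hZc ⊢
            have h5 : (U.erase q \ D).card ≤ 1 := by
              refine (Finset.card_le_card (Finset.sdiff_subset_sdiff
                (Finset.erase_subset q U) (subset_refl D))).trans ?_
              rw [Finset.card_sdiff_of_subset hDU, hU, hD]
              omega
            have h6 := (Finset.card_le_card (sdiff_triangle (Z.getLastD ∅)
              (U.erase q) D)).trans (Finset.card_union_le _ _)
            have h7 : (((Z.getLastD ∅) \ D).card : ℝ) ≤
                ((Z.getLastD ∅) \ U.erase q).card + 1 := by
              exact_mod_cast h6.trans (Nat.add_le_add_left h5 _)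
            push_cast
            linarith
        · have hSq : (S.erase q).card = S.card - 1 := Finset.card_erase_of_mem hqS
          refine ⟨B ++ [q], hlen q, hmem hqU, p, S.erase q,
            (Finset.erase_subset _ _).trans hSU, Finset.card_pos.1 (by omega), hcT, ?_,
            fun D hDU hD hSD => ?_⟩
          · rw [missSum_append_singleton, List.nil_append, hSq]
            have h4 : ∑ j ∈ Finset.Ioc (S.card - 1) k, θ j ≤
                θ S.card + ∑ j ∈ Finset.Ioc S.card k, θ j := by
              -- All `k + 1` pages are unmarked only before the very first request, whose `θ (k +
              -- 1)` is not counted.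
              rcases hScard'.eq_or_lt with he | he
              · rw [he]
                simpa using hc.trans (hθ (k + 1) (by omega) le_rfl)
              · have hI : Finset.Ioc (S.card - 1) k = insert S.card (Finset.Ioc S.card k) := by
                  ext x
                  simp only [Finset.mem_Ioc, Finset.mem_insert]
                  omega
                rw [hI, Finset.sum_insert (by simp)]
            linarith
          · obtain ⟨Z, hZ, hZc⟩ := h3 D hDU hD ((Finset.sdiff_subset_sdiff subset_rfl
              (Finset.erase_subset q S)).trans hSD)
            exact ⟨Z ++ [D], hserve (hSD (by simp [hqU])) hD hZ,
              (cost_append_pair_self _ _ _ _).trans_le hZc⟩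
  obtain ⟨B, hB, hBU, p, S, hSU, ⟨s, hs⟩, h1, h2, h3⟩ := key T le_rfl
  have hUs : (U.erase s).card = k := by rw [Finset.card_erase_of_mem (hSU hs), hU]; rfl
  obtain ⟨Z, hZ, hZc⟩ := h3 (U.erase s) (Finset.erase_subset _ _) hUs fun x hx => by
    rw [Finset.mem_sdiff] at hx
    exact Finset.mem_erase.2 ⟨fun e => hx.2 (e ▸ hs), hx.1⟩
  have hone : ∀ p : P, (0 : ℝ) ≤ (fun _ => (1 : ℝ)) p := fun _ => zero_le_one
  refine ⟨B, hB, hBU, p, (opt_le hone hZ).trans (le_trans ?_ hZc), h1, le_trans ?_ h2⟩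
  · rw [cost_append]
    exact le_add_of_nonneg_right (cost_nonneg hone _ _)
  · refine le_add_of_nonneg_right (Finset.sum_nonneg fun j hj => ?_)
    rw [Finset.mem_Ioc] at hj
    exact hc.trans (hθ j (by omega) (by omega))

/-! ### Misses of an algorithm -/

theorem run_append_singleton {P : Type*} (alg : Algorithm P) (M : List (P × List P))
    (x : P × List P) : alg.run (M ++ [x]) = alg.run M ++ [alg (M ++ [x])] := by
  simp only [Algorithm.run, List.length_append, List.length_singleton, List.range_succ,
    List.map_append, List.map_singleton]
  congr 1
  · refine List.map_congr_left fun t ht => ?_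
    rw [List.mem_range] at ht
    rw [List.take_append_of_le_length (by omega)]
  · rw [List.take_of_length_le (by simp)]

theorem messages_append_singleton {A B : List P} (b : P) (h : B.length < A.length) :
    ∃ x, messages A (B ++ [b]) = messages A B ++ [x] := by
  induction B generalizing A with
  | nil =>
    obtain _ | ⟨a, A⟩ := A
    · simp at h
    · exact ⟨(b, upTo b A), by simp [messages]⟩
  | cons c B ih =>
    obtain _ | ⟨a, A⟩ := A
    · simp at h
    · obtain ⟨x, hx⟩ := ih (A := A) (by simpa using h)
      exact ⟨x, by simp [messages, hx]⟩

/-- The cache after the requests `B`, if the predictions are `A`. -/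
def cacheAfter (alg : Algorithm P) (A B : List P) : Finset P :=
  (alg.run (messages A B)).getLastD ∅

/-- Whether the page `q` is missing after the requests `B`. -/
def miss (alg : Algorithm P) (A B : List P) (q : P) : ℝ :=
  if q ∈ cacheAfter alg A B then 0 else 1

theorem run_messages_append {A B : List P} (alg : Algorithm P) (B' : List P)
    (h : (B ++ B').length ≤ A.length) :
    ∃ Z, alg.run (messages A (B ++ B')) = alg.run (messages A B) ++ Z := by
  induction B' using List.reverseRecOn with
  | nil => exact ⟨[], by simp⟩
  | append_singleton B' b ih =>
    simp only [List.length_append, List.length_singleton] at h ih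
    obtain ⟨Z, hZ⟩ := ih (by omega)
    obtain ⟨x, hx⟩ := messages_append_singleton (A := A) (B := B ++ B') b (by simp; omega)
    rw [← List.append_assoc, hx, run_append_singleton, hZ, List.append_assoc]
    exact ⟨_, rfl⟩

theorem card_cacheAfter_le {k : ℕ} {alg : Algorithm P} (halg : alg.IsFeasible k) {A B : List P}
    (h : B.length ≤ A.length) : (cacheAfter alg A B).card ≤ k := by
  -- Feasibility concerns sequences of equal length, so `B` is padded with the rest of `A`, which
  -- does not affect the earlier caches.
  obtain ⟨Z, hZ⟩ := run_messages_append (A := A) (B := B) alg (A.drop B.length)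
    (by simp; omega)
  have hS := halg A (B ++ A.drop B.length) (by simp; omega)
  rw [hZ] at hS
  have hall : ∀ C ∈ alg.run (messages A B), C.card ≤ k := by
    intro C hC
    obtain ⟨i, hi, rfl⟩ := List.mem_iff_getElem.1 hC
    have := List.Forall₂.get hS (i := i) (by
      have := hS.length_eq
      rw [this, List.length_append]; omega) (by rw [List.length_append]; omega)
    simpa [List.getElem_append_left hi] using this.2
  rw [cacheAfter, List.getLastD_eq_getLast?]
  rcases hl : (alg.run (messages A B)).getLast? with _ | C
  · simp
  · exact hall C (List.mem_of_getLast? hl)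

/-- Every missed page is fetched, and later it is evicted or still in the cache; the cache size
serves as potential. -/
theorem missSum_miss_le {alg : Algorithm P} {k : ℕ} (halg : alg.IsFeasible k) {A B : List P}
    (h : B.length ≤ A.length) :
    missSum (miss alg A) [] B ≤
      cost (fun _ => 1) ∅ (alg.run (messages A B)) + (cacheAfter alg A B).card := by
  induction B using List.reverseRecOn with
  | nil =>
    have := cost_nonneg (w := fun _ : P => (1 : ℝ)) (fun _ => zero_le_one) ∅
      (alg.run (messages A []))
    rw [missSum]
    positivity
  | append_singleton B b ih =>
    rw [List.length_append, List.length_singleton] at h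
    have ih := ih (by omega)
    obtain ⟨x, hx⟩ := messages_append_singleton (A := A) (B := B) b (by omega)
    have hb : b ∈ cacheAfter alg A (B ++ [b]) := by
      obtain ⟨Z, hZ⟩ := run_messages_append (A := A) (B := B ++ [b]) alg
        (A.drop (B ++ [b]).length) (by simp; omega)
      have hS := halg A (B ++ [b] ++ A.drop (B ++ [b]).length) (by simp; omega)
      have hS' := List.forall₂_take (B.length + 1) hS
      rw [hZ] at hS'
      have hl : (alg.run (messages A (B ++ [b]))).length = B.length + 1 := by
        have : ∀ A B : List P, B.length ≤ A.length →
            (alg.run (messages A B)).length = B.length := by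
          intro A B
          induction B generalizing A with
          | nil => intro _; cases A <;> simp [messages, Algorithm.run]
          | cons b B ih =>
            obtain _ | ⟨a, A⟩ := A
            · simp
            · intro hAB
              simpa [messages, Algorithm.run] using ih A (by simpa using hAB)
        rw [this A (B ++ [b]) (by simp; omega), List.length_append, List.length_singleton]
      rw [List.take_left' (by simp), List.take_left' hl, hx, run_append_singleton] at hS'
      rw [cacheAfter, hx, run_append_singleton, List.getLastD_concat]
      have hS'' := List.rel_reverse hS'
      simp only [List.reverse_append, List.reverse_singleton, List.singleton_append] at hS''
      cases hS'' with
      | cons h _ => exact h.1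
    rw [missSum_append_singleton, List.nil_append]
    rw [cacheAfter, hx, run_append_singleton, List.getLastD_concat] at hb ⊢
    rw [cost_append, cost_one_singleton]
    change missSum (miss alg A) [] B + miss alg A B b ≤
      cost (fun _ => 1) ∅ (alg.run (messages A B)) +
        (((cacheAfter alg A B) \ alg (messages A B ++ [x])).card : ℝ) +
          (alg (messages A B ++ [x])).card
    generalize alg (messages A B ++ [x]) = D at hb
    have hcard : (cacheAfter alg A B).card + (if b ∈ cacheAfter alg A B then 0 else 1) ≤
        ((cacheAfter alg A B) \ D).card + D.card := by
      rw [← Finset.card_union_of_disjoint Finset.sdiff_disjoint, Finset.sdiff_union_self_eq_union]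
      split_ifs with hc
      · exact Finset.card_le_card Finset.subset_union_left
      · rw [← Finset.card_insert_of_notMem hc]
        exact Finset.card_le_card (Finset.insert_subset (Finset.mem_union_right _ hb)
          Finset.subset_union_left)
    have hcard' : ((cacheAfter alg A B).card : ℝ) + miss alg A B b ≤
        ((cacheAfter alg A B) \ D).card + D.card := by
      rw [miss]
      exact_mod_cast hcard
    linarith

theorem exists_notMem_cacheAfter {k : ℕ} {alg : Algorithm P} (halg : alg.IsFeasible k)
    {A B : List P} (h : B.length ≤ A.length) {U : Finset P} (hU : U.card = k + 1) :
    ∃ q ∈ U, q ∉ cacheAfter alg A B := by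
  by_contra! hcon
  have h1 := Finset.card_le_card (show U ⊆ cacheAfter alg A B from hcon)
  have h2 := card_cacheAfter_le halg h
  omega

theorem ell1_replicate {a : P} {B : List P} (h : a ∉ B) :
    ell1 (fun _ => (1 : ℝ)) (List.replicate B.length a) B = 2 * B.length := by
  induction B with
  | nil => simp
  | cons b B ih =>
    rw [List.mem_cons, not_or] at h
    rw [List.length_cons, List.replicate_succ, ell1_cons, ih h.2, starDist, if_neg h.1]
    push_cast
    ring

/-- The contradiction with an upper bound `f · OPT + o(ℓ₁)`. -/
theorem false_of_adversary {k : ℕ} {f c Θ : ℝ} {g : ℝ → ℝ} (hc : 0 < c)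
    (hf : ‖f‖ ≤ Θ / 4) (hg : g =o[atTop] fun x : ℝ => x)
    (h : ∀ T : ℕ, ∃ (x y o : ℝ) (p : ℕ), c * T ≤ y ∧ p * Θ ≤ y ∧ 0 ≤ o ∧ o ≤ p ∧ y ≤ x + k ∧
      x ≤ f * o + g (2 * T)) : False := by
  have hlim : Tendsto (fun T : ℕ => (2 : ℝ) * T) atTop atTop :=
    tendsto_natCast_atTop_atTop.const_mul_atTop two_pos
  -- For large `T`, `g (2 * T) ≤ c * T / 4 ≤ y / 4` and `k < c * T / 2 ≤ y / 2`; together with `f *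
  -- o ≤ y / 4` this gives `x + k < y`.
  have h1 := hlim.eventually (hg.bound (c := c / 8) (by positivity))
  have h2 : ∀ᶠ T : ℕ in atTop, 2 * (k : ℝ) < c * T :=
    (tendsto_natCast_atTop_atTop.const_mul_atTop hc).eventually_gt_atTop _
  obtain ⟨T, hT1, hT2⟩ := (h1.and h2).exists
  obtain ⟨x, y, o, p, hy1, hy2, ho, hop, hyx, hx⟩ := h T
  have h3 : g (2 * T) ≤ c * T / 4 := by
    refine (Real.le_norm_self _).trans (hT1.trans_eq ?_)
    rw [Real.norm_of_nonneg (by positivity)]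
    ring
  have h4 : f * o ≤ y / 4 :=
    calc f * o ≤ ‖f‖ * o := mul_le_mul_of_nonneg_right (Real.le_norm_self f) ho
      _ ≤ ‖f‖ * p := mul_le_mul_of_nonneg_left hop (norm_nonneg f)
      _ ≤ Θ / 4 * p := mul_le_mul_of_nonneg_right hf p.cast_nonneg
      _ ≤ y / 4 := by linarith
  linarith

theorem deterministic_lower_bound :
    ¬ ∃ f : ℕ → ℝ, f =o[atTop] (fun k : ℕ => (k : ℝ)) ∧
      ∀ (k n : ℕ) (w : Fin n → ℝ), 1 ≤ k → k < n → (∀ p, 0 < w p) →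
        ∃ (alg : Algorithm (Fin n)) (g : ℝ → ℝ), alg.IsFeasible k ∧ g =o[atTop] (fun x : ℝ => x) ∧
          ∀ A B : List (Fin n), A.length = B.length →
            alg.cost w A B ≤ f k * opt k w B + g (ell1 w A B) := by
  rintro ⟨f, hf, h⟩
  obtain ⟨k, hfk, hk⟩ := ((hf.bound (c := 1 / 4) (by norm_num)).and
    (eventually_ge_atTop 1)).exists
  obtain ⟨alg, g, halg, hg, hcost⟩ := h k (k + 2) (fun _ => 1) hk (by omega) fun _ => one_pos
  refine false_of_adversary (k := k) (f := f k) (Θ := k) one_pos ?_ hg fun T => ?_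
  · rw [Real.norm_natCast] at hfk
    linarith
  set U : Finset (Fin (k + 2)) := Finset.univ.erase 0
  have hU : U.card = k + 1 := by simp [U]
  -- Some page of `U` is always missing, with weight 1 whether marked or not, so all thresholds are
  -- 1.
  obtain ⟨B, hB, hBU, p, h1, h2, h3⟩ := exists_adversary hk hU (T := T)
    (m := miss alg (List.replicate T 0)) zero_le_one (θ := fun _ => 1) (fun _ _ _ => le_rfl)
    fun H hH S _ _ => by
      obtain ⟨q, hq, hq'⟩ := exists_notMem_cacheAfter halg (A := List.replicate T 0) (B := H)
        (by simpa using hH.le) hU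
      refine ⟨q, hq, ?_⟩
      simp only [miss, if_neg hq', le_refl, and_true]
      tauto
  have h0 : (0 : Fin (k + 2)) ∉ B := fun h => by simpa [U] using hBU 0 h
  have hlen : (List.replicate T (0 : Fin (k + 2))).length = B.length := by simp [hB]
  refine ⟨alg.cost (fun _ => 1) (List.replicate T 0) B, _, opt k (fun _ => 1) B, p, h2,
    by simpa using h3,
    le_opt hk fun S _ => cost_nonneg (fun _ => zero_le_one) _ _, h1, ?_, ?_⟩
  · refine (missSum_miss_le halg hlen.ge).trans (add_le_add_right ?_ _)
    exact_mod_cast card_cacheAfter_le halg hlen.ge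
  · have := hcost (List.replicate T 0) B hlen
    rwa [← hB, ell1_replicate h0, hB] at this

/-! ### Randomized algorithms -/

section Randomized

variable {P : Type v} [DecidableEq P] [Finite P] {k : ℕ}

attribute [local instance] RandomizedAlgorithm.measurableSpace
  RandomizedAlgorithm.isProbabilityMeasure

/-- For fixed messages the run takes finitely many values, so every function of it is bounded and
measurable. -/
theorem RandomizedAlgorithm.integrable_run (X : RandomizedAlgorithm.{u} P k)
    (M : List (P × List P)) (h : List (Finset P) → ℝ) :
    Integrable (fun ω => h ((X.alg ω).run M)) X.μ := by
  let _ : MeasurableSpace (List (Finset P)) := ⊤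
  have hmeas : Measurable fun ω => (X.alg ω).run M := by
    refine measurable_to_countable' fun L => ?_
    by_cases hL : L.length = M.length
    · have : (fun ω => (X.alg ω).run M) ⁻¹' {L} =
          ⋂ t : Fin M.length, {ω | X.alg ω (M.take (t + 1)) = L[(t : ℕ)]} := by
        ext ω
        simp only [Set.mem_preimage, Set.mem_singleton_iff, Set.mem_iInter, Set.mem_ofPred_eq]
        constructor
        · rintro rfl t
          simp [Algorithm.run]
        · intro hω
          refine list_map_range_eq hL fun i hi => ?_
          rw [hω ⟨i, hi⟩, List.getElem?_eq_getElem (by omega)]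
      rw [this]
      exact MeasurableSet.iInter fun t => X.measurable _ _
    · have : (fun ω => (X.alg ω).run M) ⁻¹' {L} = ∅ := by
        ext ω
        simp only [Set.mem_preimage, Set.mem_singleton_iff, Set.mem_empty_iff_false, iff_false]
        rintro rfl
        exact hL (by simp [Algorithm.run])
      rw [this]
      exact MeasurableSet.empty
  obtain ⟨c, hc⟩ := (((List.finite_length_eq (Finset P) M.length).image
    fun L => ‖h L‖).bddAbove)
  refine Integrable.of_bound ((measurable_from_top (f := h)).comp hmeas).aestronglyMeasurable c
    (Eventually.of_forall fun ω => hc ?_)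
  exact Set.mem_image_of_mem _ (by simp [Algorithm.run])

theorem RandomizedAlgorithm.integrable_miss (X : RandomizedAlgorithm.{u} P k) (A B : List P)
    (q : P) : Integrable (fun ω => miss (X.alg ω) A B q) X.μ :=
  X.integrable_run (messages A B) fun L => if q ∈ L.getLastD ∅ then 0 else 1

/-- The probability that the page `q` is missing after the requests `B`. -/
noncomputable def RandomizedAlgorithm.missProb (X : RandomizedAlgorithm.{u} P k) (A B : List P)
    (q : P) : ℝ :=
  ∫ ω, miss (X.alg ω) A B q ∂X.μ

/-- The adversary uses only miss probabilities, so its requests do not depend on the random bits and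
expectation is linear along them. -/
theorem RandomizedAlgorithm.integral_missSum (X : RandomizedAlgorithm.{u} P k)
    (A H B : List P) : Integrable (fun ω => missSum (miss (X.alg ω) A) H B) X.μ ∧
      ∫ ω, missSum (miss (X.alg ω) A) H B ∂X.μ = missSum (X.missProb A) H B := by
  induction B generalizing H with
  | nil => simp [missSum]
  | cons b B ih =>
    obtain ⟨h1, h2⟩ := ih (H ++ [b])
    refine ⟨(X.integrable_miss A H b).add h1, ?_⟩
    simp only [missSum]
    rw [integral_add (X.integrable_miss A H b) h1, h2, missProb]

theorem RandomizedAlgorithm.missSum_missProb_le (X : RandomizedAlgorithm.{u} P k)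
    {A B : List P} (h : B.length ≤ A.length) :
    missSum (X.missProb A) [] B ≤ X.cost (fun _ => 1) A B + k := by
  obtain ⟨h1, h2⟩ := X.integral_missSum A [] B
  have h3 : Integrable (fun ω => (X.alg ω).cost (fun _ => 1) A B) X.μ :=
    X.integrable_run (messages A B) fun L => WeightedPaging.cost (fun _ => 1) ∅ L
  rw [← h2, RandomizedAlgorithm.cost]
  have h4 : ∫ ω, ((X.alg ω).cost (fun _ => 1) A B + k) ∂X.μ =
      ∫ ω, (X.alg ω).cost (fun _ => 1) A B ∂X.μ + k := by
    rw [integral_add h3 (integrable_const _), integral_const]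
    simp
  refine le_of_le_of_eq (integral_mono h1 (h3.add (integrable_const (k : ℝ))) fun ω => ?_) h4
  refine (missSum_miss_le (X.feasible ω) h).trans (add_le_add_right ?_ _)
  change _ ≤ (k : ℝ)
  exact_mod_cast card_cacheAfter_le (X.feasible ω) h

theorem RandomizedAlgorithm.one_le_sum_missProb (X : RandomizedAlgorithm.{u} P k)
    {A B : List P} (h : B.length ≤ A.length) {U : Finset P} (hU : U.card = k + 1) :
    1 ≤ ∑ q ∈ U, X.missProb A B q := by
  simp only [missProb]
  rw [← integral_finsetSum U fun q _ => X.integrable_miss A B q]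
  have h1 : ∫ _, (1 : ℝ) ∂X.μ = 1 := by simp
  refine le_of_eq_of_le h1.symm (integral_mono (integrable_const _)
    (integrable_finsetSum U fun q _ => X.integrable_miss A B q) fun ω => ?_)
  obtain ⟨q, hq, hq'⟩ := exists_notMem_cacheAfter (X.feasible ω) h hU
  have h2 : (1 : ℝ) = miss (X.alg ω) A B q := by rw [miss, if_neg hq']
  change 1 ≤ _
  rw [h2]
  refine Finset.single_le_sum (f := fun q => miss (X.alg ω) A B q) (fun p _ => ?_) hq
  unfold miss
  split_ifs <;> norm_num

end Randomized

theorem randomized_lower_bound :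
    ¬ ∃ f : ℕ → ℝ, f =o[atTop] (fun k : ℕ => Real.log k) ∧
      ∀ (k n : ℕ) (w : Fin n → ℝ), 1 ≤ k → k < n → (∀ p, 0 < w p) →
        ∃ (X : RandomizedAlgorithm.{u, 0} (Fin n) k) (g : ℝ → ℝ), g =o[atTop] (fun x : ℝ => x) ∧
          ∀ A B : List (Fin n), A.length = B.length →
            X.cost w A B ≤ f k * opt k w B + g (ell1 w A B) := by
  rintro ⟨f, hf, h⟩
  obtain ⟨k, hfk, hk⟩ := ((hf.bound (c := 1 / 8) (by norm_num)).and
    (eventually_ge_atTop 1)).exists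
  obtain ⟨X, g, hg, hcost⟩ := h k (k + 2) (fun _ => 1) hk (by omega) fun _ => one_pos
  have hk0 : (0 : ℝ) < k := by exact_mod_cast hk
  refine false_of_adversary (k := k) (f := f k) (c := 1 / (2 * (k + 1)))
    (Θ := ∑ j ∈ Finset.Ioc 0 k, 1 / (2 * (j : ℝ))) (by positivity) ?_ hg fun T => ?_
  -- Since `log k ≤ H_k = 2 Θ`, the bound `log k / 8` on `f k` is at most `Θ / 4`.
  · have h1 : Real.log k ≤ ∑ j ∈ Finset.Ioc 0 k, (j : ℝ)⁻¹ := by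
      have h2 := log_add_one_le_harmonic k
      rw [harmonic_eq_sum_Icc] at h2
      push_cast at h2
      refine le_trans (Real.log_le_log hk0 (by linarith)) (h2.trans_eq ?_)
      rfl
    have h3 : ∑ j ∈ Finset.Ioc 0 k, 1 / (2 * (j : ℝ)) =
        (∑ j ∈ Finset.Ioc 0 k, (j : ℝ)⁻¹) / 2 := by
      rw [Finset.sum_div]
      exact Finset.sum_congr rfl fun j _ => by rw [one_div, mul_inv]; ring
    rw [Real.norm_of_nonneg (Real.log_natCast_nonneg k)] at hfk
    rw [h3]
    linarith
  set U : Finset (Fin (k + 2)) := Finset.univ.erase 0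
  have hU : U.card = k + 1 := by simp [U]
  obtain ⟨B, hB, hBU, p, h1, h2, h3⟩ := exists_adversary hk hU (T := T)
    (m := X.missProb (List.replicate T 0)) (c := 1 / (2 * ((k : ℝ) + 1))) (by positivity)
    (θ := fun j => 1 / (2 * (j : ℝ)))
    (fun j hj hj' => by
      have h4 : (0 : ℝ) < j := by exact_mod_cast hj
      have h5 : (j : ℝ) ≤ k + 1 := by exact_mod_cast hj'
      exact one_div_le_one_div_of_le (by positivity) (by linarith))
    fun H hH S hSU hS => by
      -- Otherwise the unmarked pages have total miss probability below `1 / 2` and the marked ones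
      -- at most `1 / 2`, although the sum over `U` is at least 1.
      by_contra! hcon
      have h4 := X.one_le_sum_missProb (A := List.replicate T 0) (B := H)
        (by simpa using hH.le) hU
      have hScard : (0 : ℝ) < S.card := by exact_mod_cast Finset.card_pos.2 hS
      have h5 : ∑ q ∈ S, X.missProb (List.replicate T 0) H q < 1 / 2 := by
        refine (Finset.sum_lt_sum_of_nonempty hS fun q hq => (hcon q (hSU hq)).2 hq).trans_eq ?_
        rw [Finset.sum_const, nsmul_eq_mul]
        field_simp
      have h6 : ∑ q ∈ U \ S, X.missProb (List.replicate T 0) H q ≤ 1 / 2 := by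
        refine (Finset.sum_le_card_nsmul _ _ (1 / (2 * ((k : ℝ) + 1))) fun q hq => ?_).trans ?_
        · rw [Finset.mem_sdiff] at hq
          exact ((hcon q hq.1).1 hq.2).le
        · have h7 : ((U \ S).card : ℝ) ≤ k + 1 := by
            exact_mod_cast (Finset.card_le_card Finset.sdiff_subset).trans_eq hU
          rw [nsmul_eq_mul]
          calc ((U \ S).card : ℝ) * (1 / (2 * ((k : ℝ) + 1)))
              ≤ (k + 1) * (1 / (2 * ((k : ℝ) + 1))) :=
                mul_le_mul_of_nonneg_right h7 (by positivity)
            _ = 1 / 2 := by field_simp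
      rw [← Finset.sum_sdiff hSU] at h4
      linarith
  have h0 : (0 : Fin (k + 2)) ∉ B := fun h => by simpa [U] using hBU 0 h
  have hlen : (List.replicate T (0 : Fin (k + 2))).length = B.length := by simp [hB]
  refine ⟨_, _, opt k (fun _ => 1) B, p, h2, h3,
    le_opt hk fun S _ => cost_nonneg (fun _ => zero_le_one) _ _, h1,
    X.missSum_missProb_le hlen.ge, ?_⟩
  have := hcost (List.replicate T 0) B hlen
  rwa [← hB, ell1_replicate h0, hB] at this

end WeightedPaging

open WeightedPaging

theorem theorem5 :
    -- no deterministic algorithm has cost `o(k) · OPT + o(ℓ₁)`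
    (¬ ∃ f : ℕ → ℝ, f =o[atTop] (fun k : ℕ => (k : ℝ)) ∧
      ∀ (k n : ℕ) (w : Fin n → ℝ), 1 ≤ k → k < n → (∀ p, 0 < w p) →
        ∃ (alg : Algorithm (Fin n)) (g : ℝ → ℝ), alg.IsFeasible k ∧ g =o[atTop] (fun x : ℝ => x) ∧
          ∀ A B : List (Fin n), A.length = B.length →
            alg.cost w A B ≤ f k * opt k w B + g (ell1 w A B)) ∧
    -- no randomized algorithm has expected cost `o(log k) · OPT + o(ℓ₁)`
    (¬ ∃ f : ℕ → ℝ, f =o[atTop] (fun k : ℕ => Real.log k) ∧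
      ∀ (k n : ℕ) (w : Fin n → ℝ), 1 ≤ k → k < n → (∀ p, 0 < w p) →
        ∃ (X : RandomizedAlgorithm.{u, 0} (Fin n) k) (g : ℝ → ℝ), g =o[atTop] (fun x : ℝ => x) ∧
          ∀ A B : List (Fin n), A.length = B.length →
            X.cost w A B ≤ f k * opt k w B + g (ell1 w A B)) ∧
    -- some deterministic algorithm with SPRP has cost `O(OPT + ℓ₁)`
    (∃ K : ℝ, ∀ (k n : ℕ) (w : Fin n → ℝ), 1 ≤ k → k < n → (∀ p, 0 < w p) →
      ∃ alg : Algorithm (Fin n), alg.IsFeasible k ∧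
        ∀ A B : List (Fin n), A.length = B.length →
          alg.cost w A B ≤ K * (opt k w B + ell1 w A B)) ∧
    -- `FOLLOW`, with any optimal offline strategy inside `STATIC`, has cost `O(OPT + ℓ₁)`
    (∃ K : ℝ, ∀ (k n : ℕ) (w : Fin n → ℝ), 1 ≤ k → k < n → (∀ p, 0 < w p) →
      (∃ σ, IsOptimalOffline k w σ) ∧
      ∀ σ, IsOptimalOffline k w σ → ∀ A B : List (Fin n), A.length = B.length →
        Serves k B (follow σ A B) ∧
          cost w ∅ (follow σ A B) ≤ K * (opt k w B + ell1 w A B)) := by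
  refine ⟨deterministic_lower_bound, randomized_lower_bound, ⟨5, ?_⟩, ⟨4, ?_⟩⟩
  · intro k n w hk _ hw
    have hw' : ∀ p, 0 ≤ w p := fun p => (hw p).le
    obtain ⟨σ, hσ⟩ := exists_isOptimalOffline hk hw'
    exact ⟨batchAlgorithm w σ,
      fun A B hAB => (batchAlgorithm_serves_and_cost_le hw' hk hσ hAB).1,
      fun A B hAB => (batchAlgorithm_serves_and_cost_le hw' hk hσ hAB).2⟩
  · intro k n w hk _ hw
    have hw' : ∀ p, 0 ≤ w p := fun p => (hw p).le
    exact ⟨exists_isOptimalOffline hk hw',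
      fun σ hσ A B hAB => follow_serves_and_cost_le hw' hk hσ hAB⟩
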